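/- Theorem 6. Online non-crossing matching (MNM): $2n$ points of the plane, in general position (distinct, no three collinear), arrive one by one; when a point arrives, the algorithm may irrevocably match it with one earlier unmatched point by a straight segment disjoint from all segments drawn before, or leave it unmatched for now. An online algorithm with advice is a deterministic online algorithm that may, at any time, read further bits of an infinite binary tape that an oracle has filled in advance, knowing the whole input. For $a,q\in(0,1)$ let $D(a\,\|\,q)=a\log_2\frac{a}{q}+(1-a)\log_2\frac{1-a}{1-q}$. Let $n\ge 2$ and $\alpha\in(16/17,1)$. Any online algorithm with advice for MNM that leaves at most $2(1-\alpha)n$ points unmatched on every input of $2n$ points reads at least $$\frac{\alpha}{2}\,D\!\left(\frac{2(1-\alpha)}{\alpha}\,\Big\|\,\frac14\right)n$$ bits of advice in the worst case over the inputs of $2n$ points. The same holds for MNM on a circle, where the inputs are the sequences of $2n$ distinct points at a common positive distance from the origin and the guarantee is required, and the worst case taken, only over these inputs. -/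

import Mathlib

/-- The Euclidean plane. -/
abbrev Plane := EuclideanSpace ℝ (Fin 2)

namespace MNM

/-- Input sequences of `N` points in general position: distinct points, no three on a line. -/
def generalPositionInputs (N : ℕ) : Set (Fin N → Plane) :=
  {p | Function.Injective p ∧
    ∀ i j k : Fin N, i ≠ j → i ≠ k → j ≠ k → ¬ Collinear ℝ {p i, p j, p k}}

/-- Input sequences of `N` distinct points on a common circle around the origin. -/
def circleInputs (N : ℕ) : Set (Fin N → Plane) :=
  {p | Function.Injective p ∧ ∃ r : ℝ, 0 < r ∧ ∀ i, ‖p i‖ = r}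

/-- What an algorithm may do next, when a point has arrived and is not served yet: read one more
bit from the advice tape (and be asked again), leave the point unmatched (finally, as far as
earlier points are concerned), or match it with the point number `j` in the order of arrival
(numbers start at `0`). -/
inductive Command where
  | readBit : Command
  | leave : Command
  | matchWith (j : ℕ) : Command

/-- A (deterministic) online algorithm with advice: its next command is a function of the points
that have arrived so far (in the order of arrival, the current point last) and of the advice bits
that it has read so far. -/
abbrev Algorithm := List Plane → List Bool → Command

/-- An infinite advice tape. -/
abbrev Tape := ℕ → Bool

/-- The first `b` bits of a tape. -/
def Tape.prefixBits (t : Tape) (b : ℕ) : List Bool := (List.range b).map t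

/-- The list of the first `m` points of the input. -/
def firstPoints {N : ℕ} (p : Fin N → Plane) (m : ℕ) : List Plane := (List.ofFn p).take m

/-- The point `k` is an endpoint of no pair in `M`. -/
def IsFree {N : ℕ} (M : Finset (Fin N × Fin N)) (k : Fin N) : Prop :=
  ∀ e ∈ M, e.1 ≠ k ∧ e.2 ≠ k

/-- The segment between the points `j` and `i` meets no segment of a pair in `M`. -/
def NoCrossing {N : ℕ} (p : Fin N → Plane) (M : Finset (Fin N × Fin N)) (j i : Fin N) : Prop :=
  ∀ e ∈ M, Disjoint (segment ℝ (p j) (p i)) (segment ℝ (p e.1) (p e.2))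

/-- `Reaches A t p i b M`: running `A` with advice tape `t` on the input `p`, one reaches the
situation in which the first `i` points have been served, altogether `b` bits of the tape have been
read, and `M` is the set of the pairs matched so far. A run continues only as long as the commands
are admissible: a point can be matched only with an earlier unmatched point, without crossing. -/
inductive Reaches {N : ℕ} (A : Algorithm) (t : Tape) (p : Fin N → Plane) :
    ℕ → ℕ → Finset (Fin N × Fin N) → Prop
  | start : Reaches A t p 0 0 ∅
  | readBit {i b : ℕ} {M : Finset (Fin N × Fin N)} (h : Reaches A t p i b M) (hi : i < N)
      (hc : A (firstPoints p (i + 1)) (t.prefixBits b) = Command.readBit) :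
      Reaches A t p i (b + 1) M
  | leave {i b : ℕ} {M : Finset (Fin N × Fin N)} (h : Reaches A t p i b M) (hi : i < N)
      (hc : A (firstPoints p (i + 1)) (t.prefixBits b) = Command.leave) :
      Reaches A t p (i + 1) b M
  | matchWith {i b j : ℕ} {M : Finset (Fin N × Fin N)} (h : Reaches A t p i b M) (hi : i < N)
      (hc : A (firstPoints p (i + 1)) (t.prefixBits b) = Command.matchWith j) (hj : j < i)
      (hfree : IsFree M ⟨j, hj.trans hi⟩)
      (hcross : NoCrossing p M ⟨j, hj.trans hi⟩ ⟨i, hi⟩) :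
      Reaches A t p (i + 1) b (insert (⟨j, hj.trans hi⟩, ⟨i, hi⟩) M)

/-- `Outcome A t p b M`: with advice tape `t`, the algorithm `A` serves the whole input `p`, reads
exactly `b` bits of the tape in doing so, and produces the non-crossing matching `M`. -/
def Outcome {N : ℕ} (A : Algorithm) (t : Tape) (p : Fin N → Plane) (b : ℕ)
    (M : Finset (Fin N × Fin N)) : Prop :=
  Reaches A t p N b M

/-- The number of points that the matching `M` leaves unmatched. -/
noncomputable def numUnmatched {N : ℕ} (M : Finset (Fin N × Fin N)) : ℕ :=
  {k : Fin N | IsFree M k}.ncard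

/-- An oracle sees the whole input before it writes the tape. -/
abbrev Oracle (N : ℕ) := (Fin N → Plane) → Tape

/-- With the advice of the oracle `O`, the algorithm `A` leaves at most `u` points unmatched on
every input of the class `S`. -/
def GuaranteesUnmatchedLE {N : ℕ} (A : Algorithm) (O : Oracle N) (S : Set (Fin N → Plane))
    (u : ℝ) : Prop :=
  ∀ p ∈ S, ∃ b M, Outcome A (O p) p b M ∧ (numUnmatched M : ℝ) ≤ u

/-- The binary relative entropy, in bits, between an `a`-coin and a `q`-coin. -/
noncomputable def relEntropy (a q : ℝ) : ℝ :=
  a * Real.logb 2 (a / q) + (1 - a) * Real.logb 2 ((1 - a) / (1 - q))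

end MNM

namespace MNM

/-! ### The block game -/

/-! On the unit circle with integer coordinates (`circlePoint`), segments meet whenever their
coordinates interleave, and such inputs lie in both classes. An algorithm thus plays a combinatorial
game: each arriving coordinate stays free or is joined to a free one by a chord that interleaves
with no earlier chord.

The input is random: independent blocks of six or four points, each block beyond all earlier points,
drawn with the weights in `six` and `four`. A free point weighs 1/3 if a chord covers it and 6/7
otherwise; the potential of a position is the product of these weights. Against any strategy without
advice, a block multiplies the expected potential by at most 0.613 (`six`) or 0.79 (`four`). There
may be any number of old free points, but `Simulates` compresses every position inside a block to a
small abstract one, so that a finite game, `gameValue`, bounds the factor. The kernel evaluates this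
game.

With at most `b` bits of advice, the algorithm behaves on each input like one of `2 ^ b` strategies
without advice. On every input one of them leaves at most `u` points free, hence ends with potential
at least `3⁻ᵘ`. Averaging over the inputs and summing over the strategies gives `1 ≤ 2 ^ b * 3 ^ u *
0.613 ^ c₆ * 0.79 ^ c₄` when `2 * n = 6 * c₆ + 4 * c₄` (`total_weight_le`, `one_le_of_outcomes`). If
`b` is below the claimed bound, this fails: by logarithmic estimates for `n ≥ 17`, and for `n ≤ 16`
by a finite check, since parity then forces `u = 0`. -/

/-- Strict interleaving of two chords, given by their left and right end positions. -/
def crossing (c d : ℕ × ℕ) : Bool :=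
  (Nat.blt c.1 d.1 && (Nat.blt d.1 c.2 && Nat.blt c.2 d.2)) ||
    (Nat.blt d.1 c.1 && (Nat.blt c.1 d.2 && Nat.blt d.2 c.2))

theorem crossing_eq_true {c d : ℕ × ℕ} : crossing c d = true ↔
    (c.1 < d.1 ∧ d.1 < c.2 ∧ c.2 < d.2) ∨ (d.1 < c.1 ∧ c.1 < d.2 ∧ d.2 < c.2) := by
  simp [crossing]

/-- The point `y` lies strictly between the ends of a chord. -/
def Covered (C : List (ℕ × ℕ)) (y : ℕ) : Prop := ∃ c ∈ C, c.1 < y ∧ y < c.2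

/-- Application of a function to a natural number that the kernel evaluates beforehand. -/
noncomputable def force {β : Type} (n : ℕ) (f : ℕ → β) : β :=
  Nat.rec (f 0) (fun m _ => f (Nat.succ m)) n

@[simp] theorem force_eq {β : Type} (n : ℕ) (f : ℕ → β) : force n f = f n := by
  cases n <;> rfl

/-- The chord between two positions. -/
noncomputable def chord (x y : ℕ) : ℕ × ℕ := Bool.rec (y, x) (x, y) (Nat.ble x y)

theorem chord_eq (x y : ℕ) : chord x y = (min x y, max x y) := by
  unfold chord
  cases h : Nat.ble x y
  · have : y < x := by
      rw [← Bool.not_eq_true, Nat.ble_eq] at h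
      omega
    simp [min_eq_right this.le, max_eq_left this.le]
  · rw [Nat.ble_eq] at h
    simp [h]

/-- `List.foldr` by plain recursion, which the kernel evaluates fast. -/
noncomputable def foldR {α β : Type} (f : α → β → β) (b : β) (l : List α) : β :=
  List.rec b (fun a _ ih => f a ih) l

@[simp] theorem foldR_nil {α β : Type} (f : α → β → β) (b : β) : foldR f b [] = b := rfl

@[simp] theorem foldR_cons {α β : Type} (f : α → β → β) (b : β) (a : α) (l : List α) :
    foldR f b (a :: l) = f a (foldR f b l) := rfl

/-- The number of points of `U` that are covered by `C`. -/
noncomputable def countCovered (C : List (ℕ × ℕ)) (U : List ℕ) : ℕ :=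
  foldR (fun y n => Bool.rec n (n + 1)
    (foldR (fun c b => Bool.rec b true (Nat.blt c.1 y && Nat.blt y c.2)) false C)) 0 U

/-- The chord `d` crosses no chord of `C`. -/
noncomputable def compatible (C : List (ℕ × ℕ)) (d : ℕ × ℕ) : Bool :=
  foldR (fun c b => Bool.rec b false (crossing c d)) true C

theorem compatible_eq_true {C : List (ℕ × ℕ)} {d : ℕ × ℕ} :
    compatible C d = true ↔ ∀ c ∈ C, ¬ crossing c d = true := by
  unfold compatible
  induction C with
  | nil => simp
  | cons c C ih => cases h : crossing c d <;> simp_all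

theorem foldR_covered (C : List (ℕ × ℕ)) (y : ℕ) :
    foldR (fun c b => Bool.rec b true (Nat.blt c.1 y && Nat.blt y c.2)) false C = true ↔
      Covered C y := by
  unfold Covered
  induction C with
  | nil => simp
  | cons c C ih =>
    have h : (Nat.blt c.1 y && Nat.blt y c.2) = true ↔ c.1 < y ∧ y < c.2 := by simp
    rw [foldR_cons, List.exists_mem_cons_iff, ← h, ← ih]
    cases (Nat.blt c.1 y && Nat.blt y c.2) <;> simp

open Classical in
theorem countCovered_cons (C : List (ℕ × ℕ)) (y : ℕ) (U : List ℕ) :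
    countCovered C (y :: U) = if Covered C y then countCovered C U + 1 else countCovered C U := by
  have h := foldR_covered C y
  rw [countCovered, foldR_cons, ← countCovered]
  split_ifs with hy
  · rw [h.2 hy]
  · rw [← h, Bool.not_eq_true] at hy
    rw [hy]

theorem countCovered_le (C : List (ℕ × ℕ)) (U : List ℕ) : countCovered C U ≤ U.length := by
  induction U with
  | nil => exact le_rfl
  | cons y U ih =>
    rw [countCovered_cons, List.length_cons]
    split_ifs <;> omega

/-- The scaled weight of a final position of the block game. -/
noncomputable def leafWeight (U : List ℕ) (C : List (ℕ × ℕ)) (s : ℕ) : ℕ :=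
  force (countCovered C U) fun a =>
    3 ^ (24 - a) * 6 ^ (24 + (U.length - a) - s) * 7 ^ (24 + s - (U.length - a))

/-- The maximum, in a form that the kernel evaluates fast. -/
noncomputable def natMax (a b : ℕ) : ℕ :=
  force a fun a => force b fun b => Bool.rec a b (Nat.ble a b)

theorem natMax_eq (a b : ℕ) : natMax a b = max a b := by
  simp only [natMax, force_eq]
  cases h : Nat.ble a b
  · rw [← Bool.not_eq_true, Nat.ble_eq] at h
    exact (max_eq_left (not_le.1 h).le).symm
  · rw [Nat.ble_eq] at h
    exact (max_eq_right h).symm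

/-- `List.erase` by plain recursion. -/
noncomputable def eraseNat (a : ℕ) (l : List ℕ) : List ℕ :=
  List.rec [] (fun b l ih => Bool.rec (b :: ih) l (Nat.beq b a)) l

theorem eraseNat_cons (a b : ℕ) (l : List ℕ) :
    eraseNat a (b :: l) = Bool.rec (b :: eraseNat a l) l (Nat.beq b a) := rfl

theorem eraseNat_eq (a : ℕ) (l : List ℕ) : eraseNat a l = l.erase a := by
  induction l with
  | nil => rfl
  | cons b l ih =>
    rw [eraseNat_cons, ih, List.erase_cons]
    have h : Nat.beq b a = (b == a) := by
      rw [Bool.eq_iff_iff, Nat.beq_eq, beq_iff_eq]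
    rw [h]
    cases b == a <;> rfl

/-- The first positions of the sequences of a weighted list. -/
def heads : List (ℕ × List ℕ) → List ℕ
  | [] => []
  | a :: l => bif (heads l).any (Nat.beq a.2.headI) then heads l else a.2.headI :: heads l

theorem mem_heads {l : List (ℕ × List ℕ)} {a : ℕ × List ℕ} (ha : a ∈ l) :
    a.2.headI ∈ heads l := by
  induction l with
  | nil => simp at ha
  | cons b l ih =>
    rw [heads]
    cases h : (heads l).any (Nat.beq b.2.headI)
    · rcases List.mem_cons.1 ha with rfl | ha
      · simp
      · simp [ih ha]
    · rcases List.mem_cons.1 ha with rfl | ha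
      · obtain ⟨x, hx, hxa⟩ := List.any_eq_true.1 h
        rw [Nat.eq_of_beq_eq_true hxa]
        simpa using hx
      · simpa using ih ha

/-- The entries of a list without repetitions. -/
noncomputable def distinct (l : List ℕ) : List ℕ :=
  List.rec [] (fun a l ih => Bool.rec (a :: ih) ih
    (foldR (fun b t => Bool.rec t true (Nat.beq a b)) false l)) l

theorem distinct_cons (a : ℕ) (l : List ℕ) : distinct (a :: l) = Bool.rec (a :: distinct l)
    (distinct l) (foldR (fun b t => Bool.rec t true (Nat.beq a b)) false l) := rfl

theorem mem_of_foldR_beq {a : ℕ} {l : List ℕ}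
    (h : foldR (fun b t => Bool.rec t true (Nat.beq a b)) false l = true) : a ∈ l := by
  induction l with
  | nil => simp at h
  | cons b l ih =>
    rw [foldR_cons] at h
    cases hb : Nat.beq a b
    · rw [hb] at h
      exact List.mem_cons_of_mem _ (ih h)
    · rw [Nat.eq_of_beq_eq_true hb]
      exact List.mem_cons_self

theorem mem_distinct {a : ℕ} {l : List ℕ} (h : a ∈ l) : a ∈ distinct l := by
  induction l with
  | nil => simp at h
  | cons b l ih =>
    rw [distinct_cons]
    cases hb : foldR (fun c t => Bool.rec t true (Nat.beq b c)) false l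
    · rcases List.mem_cons.1 h with rfl | h
      · exact List.mem_cons_self
      · exact List.mem_cons_of_mem _ (ih h)
    · rcases List.mem_cons.1 h with rfl | h
      · exact ih (mem_of_foldR_beq hb)
      · exact ih h

/-- The maximum of `f` over a list. -/
noncomputable def maxOf (f : ℕ → ℕ) (l : List ℕ) : ℕ := foldR (fun a n => natMax (f a) n) 0 l

theorem le_maxOf (f : ℕ → ℕ) {l : List ℕ} {a : ℕ} (h : a ∈ l) : f a ≤ maxOf f l := by
  induction l with
  | nil => simp at h
  | cons b l ih =>
    rw [maxOf, foldR_cons, ← maxOf, natMax_eq]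
    rcases List.mem_cons.1 h with rfl | h
    · exact le_max_left _ _
    · exact (ih h).trans (le_max_right _ _)

/-- The sequences of `ls` that begin with `x`, without this first entry. -/
def tails (x : ℕ) (ls : List (ℕ × List ℕ)) : List (ℕ × List ℕ) :=
  (ls.filter fun l => Nat.beq l.2.headI x).map fun l => (l.1, l.2.tail)

/-- The best value for the player after the arrival of `x`, when `v` evaluates the positions of the
remaining game. The abstract position consists of the free points `U` of the block, the chords `C`,
the least coordinate `t` in use, and the number `s` of older points that were used up or hidden;
`k` more points will arrive. -/
noncomputable def moveValue (v : List ℕ → List (ℕ × ℕ) → ℕ → ℕ → ℕ) (k : ℕ) (U : List ℕ)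
    (C : List (ℕ × ℕ)) (t s x : ℕ) : ℕ :=
  natMax (v (x :: U) C t s) <| natMax
    (maxOf (fun y => Prod.rec (fun a b => Bool.rec 0 (v (eraseNat y U) ((a, b) :: C) t s)
      (compatible C (a, b))) (chord y x)) (distinct U))
    (force t fun t => Bool.rec 0
      (maxOf (fun r => v (List.replicate r (t - 1) ++ U) ((t - 2, x) :: C) (t - 2) (s + r + 1))
        (List.range (k + 1))) (compatible C (t - 2, x)))

/-- An upper bound for the scaled value of the block game for an input drawn from `ls`. -/
noncomputable def gameValue (k : ℕ) :
    List (ℕ × List ℕ) → List ℕ → List (ℕ × ℕ) → ℕ → ℕ → ℕ :=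
  Nat.rec (fun ls U C _ s => foldR (fun a n => a.1 + n) 0 ls * leafWeight U C s)
    (fun k ih ls U C t s => foldR (fun x n => Nat.add (force x fun x =>
      (fun ls' => moveValue (ih ls') k U C t s x) (tails x ls)) n) 0 (heads ls)) k

theorem gameValue_zero (ls : List (ℕ × List ℕ)) (U : List ℕ) (C : List (ℕ × ℕ)) (t s : ℕ) :
    gameValue 0 ls U C t s = (ls.map Prod.fst).sum * leafWeight U C s := by
  change foldR (fun a n => a.1 + n) 0 ls * leafWeight U C s = _
  congr 1
  induction ls with
  | nil => rfl
  | cons a l ih => simp [ih]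

theorem gameValue_succ (k : ℕ) (ls : List (ℕ × List ℕ)) (U : List ℕ) (C : List (ℕ × ℕ))
    (t s : ℕ) : gameValue (k + 1) ls U C t s =
      ((heads ls).map fun x => moveValue (gameValue k (tails x ls)) k U C t s x).sum := by
  change foldR (fun x n => Nat.add (force x fun x =>
    moveValue (gameValue k (tails x ls)) k U C t s x) n) 0 (heads ls) = _
  simp only [force_eq]
  induction heads ls with
  | nil => rfl
  | cons a l ih => rw [foldR_cons, ih, List.map_cons, List.sum_cons, Nat.add_eq]

theorem leave_le_moveValue (v : List ℕ → List (ℕ × ℕ) → ℕ → ℕ → ℕ) (k : ℕ) (U : List ℕ)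
    (C : List (ℕ × ℕ)) (t s x : ℕ) : v (x :: U) C t s ≤ moveValue v k U C t s x := by
  rw [moveValue, natMax_eq]
  exact le_max_left _ _

theorem inner_le_moveValue (v : List ℕ → List (ℕ × ℕ) → ℕ → ℕ → ℕ) (k : ℕ) {U : List ℕ}
    {C : List (ℕ × ℕ)} (t s : ℕ) {x y : ℕ} (hy : y ∈ U) (h : compatible C (chord y x) = true) :
    v (U.erase y) (chord y x :: C) t s ≤ moveValue v k U C t s x := by
  rw [moveValue, natMax_eq, natMax_eq]
  refine le_max_of_le_right (le_max_of_le_left ?_)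
  refine le_trans ?_ (le_maxOf _ (mem_distinct hy))
  rw [← Prod.mk.eta (p := chord y x)] at h
  simp only [eraseNat_eq, h]
  exact le_rfl

theorem outer_le_moveValue (v : List ℕ → List (ℕ × ℕ) → ℕ → ℕ → ℕ) {k : ℕ} (U : List ℕ)
    {C : List (ℕ × ℕ)} {t : ℕ} (s : ℕ) {x r : ℕ} (hr : r ≤ k)
    (h : compatible C (t - 2, x) = true) :
    v (List.replicate r (t - 1) ++ U) ((t - 2, x) :: C) (t - 2) (s + r + 1) ≤
      moveValue v k U C t s x := by
  rw [moveValue, natMax_eq, natMax_eq]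
  refine le_max_of_le_right (le_max_of_le_right ?_)
  rw [force_eq, h]
  exact le_maxOf (fun r => v (List.replicate r (t - 1) ++ U) ((t - 2, x) :: C) (t - 2) (s + r + 1))
    (List.mem_range.2 (Nat.lt_succ_of_le hr))

/-! ### The two input distributions and the values of their games. -/

/-- A weighted list of sequences of six positions. -/
def six : List (ℕ × List ℕ) :=
  [(9, [32, 48, 64, 24, 20, 28]),
   (9, [32, 48, 64, 24, 28, 20]),
   (5, [32, 48, 64, 24, 40, 56]),
   (7, [32, 48, 64, 24, 72, 40]),
   (16, [32, 48, 64, 24, 72, 68]),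
   (16, [32, 48, 64, 24, 72, 76]),
   (7, [32, 48, 64, 40, 36, 44]),
   (12, [32, 48, 64, 40, 44, 36]),
   (7, [32, 48, 64, 40, 72, 24]),
   (7, [32, 48, 64, 40, 72, 56]),
   (17, [32, 48, 64, 40, 72, 68]),
   (16, [32, 48, 64, 40, 72, 76]),
   (12, [32, 48, 64, 56, 52, 60]),
   (9, [32, 48, 64, 56, 60, 52]),
   (10, [32, 48, 64, 56, 72, 24]),
   (7, [32, 48, 64, 56, 72, 40]),
   (18, [32, 48, 64, 56, 72, 68]),
   (14, [32, 48, 64, 56, 72, 76])]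

/-- A weighted list of sequences of four positions. -/
def four : List (ℕ × List ℕ) :=
  [(14, [48, 32, 40, 24]),
   (12, [48, 32, 40, 36]),
   (14, [48, 32, 40, 44]),
   (19, [48, 64, 72, 56]),
   (19, [48, 64, 72, 68]),
   (22, [48, 64, 72, 76])]

-- Here 198 is the total weight of `six` and `126 ^ 24` the scale of `leafWeight`, so the mean
-- factor is at most 0.613. The proof is an exhaustive evaluation of the game tree; the same holds
-- for `four` with total weight 100 and factor 0.79.
set_option maxRecDepth 100000 in
theorem gameValue_six_le :
    1000 * gameValue 6 six [] [] 14 0 ≤ 613 * 198 * 126 ^ 24 := by decide +kernel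

set_option maxRecDepth 100000 in
theorem gameValue_four_le :
    100 * gameValue 4 four [] [] 14 0 ≤ 79 * 100 * 126 ^ 24 := by decide +kernel

/-! ### Positions on the line of arrival coordinates -/

open Classical in
/-- The weight of an unmatched point: covered points count less. -/
noncomputable def pointWeight (C : List (ℕ × ℕ)) (y : ℕ) : ℝ :=
  if Covered C y then 1 / 3 else 6 / 7

theorem pointWeight_pos (C : List (ℕ × ℕ)) (y : ℕ) : 0 < pointWeight C y := by
  unfold pointWeight
  split_ifs <;> norm_num

theorem third_le_pointWeight (C : List (ℕ × ℕ)) (y : ℕ) : 1 / 3 ≤ pointWeight C y := by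
  unfold pointWeight
  split_ifs <;> norm_num

theorem pointWeight_le_pointWeight {C C' : List (ℕ × ℕ)} {y y' : ℕ}
    (h : Covered C' y' → Covered C y) : pointWeight C y ≤ pointWeight C' y' := by
  unfold pointWeight
  split_ifs with h1 h2 h2
  · exact le_rfl
  · norm_num
  · exact absurd (h h2) h1
  · exact le_rfl

theorem pointWeight_of_not_covered {C : List (ℕ × ℕ)} {y : ℕ} (h : ¬ Covered C y) :
    pointWeight C y = 6 / 7 := if_neg h

/-- The unmatched points and the chords. -/
abbrev Position := Finset ℕ × List (ℕ × ℕ)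

/-- The arrival of `x`, which is left unmatched or matched with an earlier point. -/
noncomputable def move (g : Position) (x : ℕ) : Option ℕ → Position
  | none => (insert x g.1, g.2)
  | some y => (g.1.erase y, chord y x :: g.2)

/-- A point may be matched with an unmatched point along a chord that crosses no other chord. -/
def LegalMove (g : Position) (x : ℕ) : Option ℕ → Prop
  | none => True
  | some y => y ∈ g.1 ∧ compatible g.2 (chord y x) = true

/-- The position after the arrivals `l`, served according to the decisions `D`. -/
noncomputable def run : Position → List ℕ → List (Option ℕ) → Position
  | g, x :: l, d :: D => run (move g x d) l D
  | g, _, _ => g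

/-- All decisions are legal, and there is one for each arrival. -/
def LegalRun : Position → List ℕ → List (Option ℕ) → Prop
  | g, x :: l, d :: D => LegalMove g x d ∧ LegalRun (move g x d) l D
  | _, [], [] => True
  | _, _, _ => False

/-- The product of the weights of the unmatched points. -/
noncomputable def potential (g : Position) : ℝ := ∏ y ∈ g.1, pointWeight g.2 y

theorem potential_pos (g : Position) : 0 < potential g :=
  Finset.prod_pos fun _ _ => pointWeight_pos _ _

theorem pow_card_le_potential (g : Position) : (1 / 3 : ℝ) ^ g.1.card ≤ potential g := by
  rw [← Finset.prod_const]
  exact Finset.prod_le_prod (fun _ _ => by norm_num) fun _ _ => third_le_pointWeight _ _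

/-- The abstract position `Ua, Ca, t, s` dominates the position `U, C` in the middle of a block
that uses the coordinates above `off`. The map `f` collapses coordinates, the abstract free points
are the images of `Q`, and the points below `cur` are not represented. -/
structure Simulates (off : ℕ) (C₀ : List (ℕ × ℕ)) (w : ℝ) (k : ℕ) (Ua : List ℕ)
    (Ca : List (ℕ × ℕ)) (t s : ℕ) (U : Finset ℕ) (C : List (ℕ × ℕ)) (f : ℕ → ℕ) (cur : ℕ)
    (Q : Finset ℕ) : Prop where
  mono : Monotone f
  shift : ∀ x, 14 < x → f (off + x) = x
  low : ∀ y ≤ off, f y ≤ 14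
  below : ∀ y < cur, f y < t
  above : ∀ y, cur ≤ y → t ≤ f y
  cur_le : cur ≤ off + 15
  -- Each match with a point below `cur` consumes two fresh abstract coordinates, `t - 1` and `t -
  -- 2`.
  room : 2 * k + 1 ≤ t
  le_start : t ≤ 14
  old_le : ∀ c ∈ C₀, c.2 ≤ off
  old_mem : ∀ c ∈ C₀, c ∈ C
  points : (Ua : Multiset ℕ) = Q.val.map f
  subset : Q ⊆ U
  cur_le_of_mem : ∀ y ∈ Q, cur ≤ y
  new_gap : ∀ y ∈ U, off < y → off + 14 < y
  new_mem : ∀ y ∈ U, off < y → y ∈ Q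
  visible : ∀ y ∈ Q, y ≤ off → ¬ Covered C₀ y
  -- A visible old point may stay unrepresented only if its class under `f` already has `k`
  -- representatives, enough for the `k` arrivals to come.
  spare : ∀ y ∈ U, cur ≤ y → y ≤ off → ¬ Covered C₀ y → y ∉ Q →
    k ≤ (Q.filter fun z => f z = f y).card
  chords : ∀ c' ∈ Ca, ∃ c ∈ C, c' = (f c.1, f c.2) ∧ cur ≤ c.1 ∧ c.1 ≤ c.2
  -- Here `w` is the potential before the block. Each visible old point that was matched from below
  -- `cur` or moved into `Q` is counted once in `s`; hence the old points outside `Q` have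
  -- `C₀`-weight `w * (7 / 6) ^ s`.
  weight : (∏ y ∈ U with y ≤ off, pointWeight C₀ y) * (6 / 7) ^ s =
    w * (6 / 7) ^ (Q.filter fun y => y ≤ off).card

/-! ### The abstract game keeps up with every legal move inside a block. -/

namespace Simulates

variable {off : ℕ} {C₀ : List (ℕ × ℕ)} {w : ℝ} {k : ℕ} {Ua : List ℕ} {Ca : List (ℕ × ℕ)} {t s : ℕ}
  {U : Finset ℕ} {C : List (ℕ × ℕ)} {f : ℕ → ℕ} {cur : ℕ} {Q : Finset ℕ}

/-- Before the block nothing is represented: all coordinates up to `off + 14` collapse to 0. The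
start value 14 leaves room for six matches with old points. -/
theorem start {U₀ : Finset ℕ} (hk : k ≤ 6) (hU : ∀ y ∈ U₀, y ≤ off) (hC : ∀ c ∈ C₀, c.2 ≤ off) :
    Simulates off C₀ (potential (U₀, C₀)) k [] [] 14 0 U₀ C₀
      (fun y => if y ≤ off + 14 then 0 else y - off) (off + 15) ∅ where
  mono a b hab := by
    dsimp only
    split_ifs <;> omega
  shift x hx := by
    split_ifs <;> omega
  low y hy := by
    split_ifs <;> omega
  below y hy := by
    split_ifs <;> omega
  above y hy := by
    split_ifs <;> omega
  cur_le := le_rfl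
  room := by omega
  le_start := le_rfl
  old_le := hC
  old_mem c hc := hc
  points := by simp
  subset := by simp
  cur_le_of_mem := by simp
  new_gap y hy hlt := absurd (hU y hy) (not_le.2 hlt)
  new_mem y hy hlt := absurd (hU y hy) (not_le.2 hlt)
  visible := by simp
  spare y hy hcur hle := by omega
  chords := by simp
  weight := by
    rw [Finset.filter_true_of_mem hU]
    simp [potential]

theorem leave (h : Simulates off C₀ w (k + 1) Ua Ca t s U C f cur Q) {x : ℕ} (hx : 16 < x)
    (hxU : off + x ∉ U) :
    Simulates off C₀ w k (x :: Ua) Ca t s (insert (off + x) U) C f cur (insert (off + x) Q) where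
  mono := h.mono
  shift := h.shift
  low := h.low
  below := h.below
  above := h.above
  cur_le := h.cur_le
  room := by have := h.room; omega
  le_start := h.le_start
  old_le := h.old_le
  old_mem := h.old_mem
  points := by
    rw [Finset.insert_val_of_notMem fun hQ => hxU (h.subset hQ), Multiset.map_cons,
      h.shift x (by omega), ← h.points]
    rfl
  subset := Finset.insert_subset_insert _ h.subset
  cur_le_of_mem := by
    intro y hy
    rcases Finset.mem_insert.1 hy with rfl | hy
    · have := h.cur_le; omega
    · exact h.cur_le_of_mem y hy
  new_gap y hy hlt := by
    rcases Finset.mem_insert.1 hy with rfl | hy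
    · omega
    · exact h.new_gap y hy hlt
  new_mem y hy hlt := by
    rcases Finset.mem_insert.1 hy with rfl | hy
    · exact Finset.mem_insert_self _ _
    · exact Finset.mem_insert_of_mem (h.new_mem y hy hlt)
  visible y hy hle := by
    rcases Finset.mem_insert.1 hy with rfl | hy
    · omega
    · exact h.visible y hy hle
  spare y hy hcur hle hv hyQ := by
    rw [Finset.mem_insert, not_or] at hyQ
    have hyU : y ∈ U := (Finset.mem_insert.1 hy).resolve_left hyQ.1
    refine (Nat.le_succ k).trans ((h.spare y hyU hcur hle hv hyQ.2).trans ?_)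
    exact Finset.card_le_card (Finset.filter_subset_filter _ (Finset.subset_insert _ _))
  chords := h.chords
  weight := by
    rw [Finset.filter_insert, if_neg (by omega), Finset.filter_insert, if_neg (by omega)]
    exact h.weight

/-- New points lie to the right of all old chords, so a chord from a covered old point to a new one
would leave the covering chord and cross it. -/
theorem not_covered_of_compatible (h : Simulates off C₀ w k Ua Ca t s U C f cur Q) {x y : ℕ}
    (hx : 0 < x) (hle : y ≤ off) (hcomp : compatible C (chord y (off + x)) = true) :
    ¬ Covered C₀ y := by
  rintro ⟨c, hc, hlt, hgt⟩
  have h2 := h.old_le c hc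
  refine compatible_eq_true.1 hcomp c (h.old_mem c hc) (crossing_eq_true.2 (Or.inl ?_))
  rw [chord_eq, min_eq_left (by omega), max_eq_right (by omega)]
  exact ⟨hlt, hgt, by dsimp only; omega⟩

/-- A monotone map reflects strict inequalities. Collapsing coordinates therefore creates no
crossing, and the abstract player is never more restricted than the real one. -/
theorem crossing_of_crossing_map {f : ℕ → ℕ} (hf : Monotone f) {a b c d : ℕ}
    (h : crossing (f a, f b) (f c, f d) = true) : crossing (a, b) (c, d) = true := by
  rw [crossing_eq_true] at h ⊢
  exact h.imp (fun h => ⟨hf.reflect_lt h.1, hf.reflect_lt h.2.1, hf.reflect_lt h.2.2⟩)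
    fun h => ⟨hf.reflect_lt h.1, hf.reflect_lt h.2.1, hf.reflect_lt h.2.2⟩

theorem filter_prod_erase {y : ℕ} (hy : y ∈ U) (hle : y ≤ off) (hv : ¬ Covered C₀ y) :
    (∏ z ∈ U with z ≤ off, pointWeight C₀ z) =
      (6 / 7) * ∏ z ∈ U.erase y with z ≤ off, pointWeight C₀ z := by
  rw [Finset.filter_erase, ← pointWeight_of_not_covered hv, Finset.mul_prod_erase]
  exact Finset.mem_filter.2 ⟨hy, hle⟩

/-- Spare points are interchangeable with represented ones: the class of an unrepresented `y` has at
least `k + 1` representatives. They are old like `y`, because `f` sends new points above 14 and old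
ones to at most 14. -/
theorem exists_representative (h : Simulates off C₀ w (k + 1) Ua Ca t s U C f cur Q) {y : ℕ}
    (hyU : y ∈ U) (hcur : cur ≤ y) (hv : y ≤ off → ¬ Covered C₀ y) :
    ∃ z ∈ Q, f z = f y ∧ (z ≤ off ↔ y ≤ off) ∧ (y ∈ Q → z = y) := by
  by_cases hyQ : y ∈ Q
  · exact ⟨y, hyQ, rfl, Iff.rfl, fun _ => rfl⟩
  · have hle : y ≤ off := by
      by_contra hlt
      exact hyQ (h.new_mem y hyU (not_le.1 hlt))
    have hcard := h.spare y hyU hcur hle (hv hle) hyQ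
    obtain ⟨z, hz⟩ := Finset.card_pos.1 (lt_of_lt_of_le (Nat.succ_pos k) hcard)
    rw [Finset.mem_filter] at hz
    refine ⟨z, hz.1, hz.2, ⟨fun _ => hle, fun _ => ?_⟩, fun hQ => absurd hQ hyQ⟩
    by_contra hlt
    have hgap := h.new_gap z (h.subset hz.1) (not_le.1 hlt)
    have hshift := h.shift (z - off) (by omega)
    rw [Nat.add_sub_cancel' (by omega)] at hshift
    have := h.low y hle
    omega

theorem map_chord {f : ℕ → ℕ} (hf : Monotone f) (x y : ℕ) :
    chord (f x) (f y) = (f (chord x y).1, f (chord x y).2) := by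
  simp only [chord_eq, hf.map_min, hf.map_max]

theorem compatible_map (h : Simulates off C₀ w k Ua Ca t s U C f cur Q) {d : ℕ × ℕ}
    (hcomp : compatible C d = true) : compatible Ca (f d.1, f d.2) = true := by
  rw [compatible_eq_true] at hcomp ⊢
  intro c' hc' hcross
  obtain ⟨c, hc, rfl, -, -⟩ := h.chords c' hc'
  exact hcomp c hc (crossing_of_crossing_map h.mono hcross)

/-- A match with a point from the represented range. The real game loses `y` and the abstract one a
representative `z` with the same image; when `y` was spare, it is `z` that becomes spare. -/
theorem inner (h : Simulates off C₀ w (k + 1) Ua Ca t s U C f cur Q) {x y : ℕ} (hx : 16 < x)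
    (hyU : y ∈ U) (hcur : cur ≤ y) (hcomp : compatible C (chord y (off + x)) = true) :
    ∃ Q', f y ∈ Ua ∧ compatible Ca (chord (f y) x) = true ∧
      Simulates off C₀ w k (Ua.erase (f y)) (chord (f y) x :: Ca) t s (U.erase y)
        (chord y (off + x) :: C) f cur Q' := by
  have hv : y ≤ off → ¬ Covered C₀ y := fun hle =>
    h.not_covered_of_compatible (by omega) hle hcomp
  obtain ⟨z, hz, hfz, hzold, hzy⟩ := h.exists_representative hyU hcur hv
  have hchord : chord (f y) x = (f (chord y (off + x)).1, f (chord y (off + x)).2) := by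
    rw [← map_chord h.mono, h.shift x (by omega)]
  refine ⟨Q.erase z, ?_, ?_, ?_⟩
  · rw [← Multiset.mem_coe, h.points, ← hfz]
    exact Multiset.mem_map_of_mem f hz
  · rw [hchord]
    exact h.compatible_map hcomp
  · exact {
      mono := h.mono
      shift := h.shift
      low := h.low
      below := h.below
      above := h.above
      cur_le := h.cur_le
      room := by have := h.room; omega
      le_start := h.le_start
      old_le := h.old_le
      old_mem := fun c hc => List.mem_cons_of_mem _ (h.old_mem c hc)
      points := by
        rw [← Multiset.coe_erase, h.points, Finset.erase_val, ← hfz,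
          Multiset.map_erase_of_mem f _ hz]
      subset := by
        intro v hvQ
        rw [Finset.mem_erase] at hvQ ⊢
        refine ⟨?_, h.subset hvQ.2⟩
        rintro rfl
        exact hvQ.1 (hzy hvQ.2).symm
      cur_le_of_mem := fun v hvQ => h.cur_le_of_mem v (Finset.mem_of_mem_erase hvQ)
      new_gap := fun v hvU => h.new_gap v (Finset.mem_of_mem_erase hvU)
      new_mem := by
        intro v hvU hlt
        rw [Finset.mem_erase] at hvU ⊢
        refine ⟨?_, h.new_mem v hvU.2 hlt⟩
        rintro rfl
        have hy : ¬ y ≤ off := fun hle => absurd (hzold.2 hle) (not_le.2 hlt)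
        exact hvU.1 (hzy (h.new_mem y hyU (not_le.1 hy)))
      visible := fun v hvQ => h.visible v (Finset.mem_of_mem_erase hvQ)
      spare := by
        intro v hvU hvcur hle hvv hvQ
        rw [Finset.mem_erase] at hvU
        -- The only newly unrepresented point can be `z` itself; then `y` was spare in the same
        -- class and supplies the count.
        have hcard : k + 1 ≤ (Q.filter fun z => f z = f v).card := by
          by_cases hvQ' : v ∈ Q
          · have hvz : v = z := by
              by_contra hne
              exact hvQ (Finset.mem_erase.2 ⟨hne, hvQ'⟩)
            subst hvz
            have hyQ : y ∉ Q := fun hyQ => hvU.1 (hzy hyQ)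
            have hyle := hzold.1 hle
            rw [hfz]
            exact h.spare y hyU hcur hyle (hv hyle) hyQ
          · exact h.spare v hvU.2 hvcur hle hvv hvQ'
        rw [Finset.filter_erase]
        have := Finset.pred_card_le_card_erase (a := z) (s := Q.filter fun z => f z = f v)
        omega
      chords := by
        intro c' hc'
        rcases List.mem_cons.1 hc' with rfl | hc'
        · refine ⟨_, List.mem_cons_self, hchord, ?_, ?_⟩
          · rw [chord_eq]
            have := h.cur_le
            exact le_min hcur (by omega)
          · rw [chord_eq]
            exact min_le_max
        · obtain ⟨c, hc, hh⟩ := h.chords c' hc'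
          exact ⟨c, List.mem_cons_of_mem _ hc, hh⟩
      weight := by
        have hw := h.weight
        by_cases hle : y ≤ off
        · have hzQ : z ∈ Q.filter fun v => v ≤ off := Finset.mem_filter.2 ⟨hz, hzold.2 hle⟩
          rw [filter_prod_erase hyU hle (hv hle), ← Finset.card_erase_add_one hzQ, pow_succ] at hw
          rw [Finset.filter_erase (fun v => v ≤ off) _ Q]
          linarith
        · have hyU' : y ∉ U.filter fun v => v ≤ off := fun hm => hle (Finset.mem_filter.1 hm).2
          have hzQ : z ∉ Q.filter fun v => v ≤ off :=
            fun hm => hle (hzold.1 (Finset.mem_filter.1 hm).2)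
          rw [Finset.filter_erase (fun v => v ≤ off) _ U,
            Finset.filter_erase (fun v => v ≤ off) _ Q, Finset.erase_eq_of_notMem hyU',
            Finset.erase_eq_of_notMem hzQ]
          exact hw }

/-- A match with an old point to the left of everything represented. The new chord encloses the
visible old points between `y` and `cur`. These can still be matched under it, but only by the `k`
arrivals to come, so at most `k` of them need representatives. They all share the coordinate `t -
1`, since no chord separates them in the abstract position; `y` gets `t - 2`. -/
theorem outer (h : Simulates off C₀ w (k + 1) Ua Ca t s U C f cur Q) {x y : ℕ} (hx : 16 < x)
    (hyU : y ∈ U) (hcur : y < cur) (hcomp : compatible C (chord y (off + x)) = true) :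
    ∃ r f' Q', r ≤ k ∧ compatible Ca (t - 2, x) = true ∧
      Simulates off C₀ w k (List.replicate r (t - 1) ++ Ua) ((t - 2, x) :: Ca) (t - 2) (s + r + 1)
        (U.erase y) (chord y (off + x) :: C) f' y Q' := by
  have hcur' := h.cur_le
  have hroom := h.room
  have hstart := h.le_start
  have hle : y ≤ off := by
    by_contra hlt
    have := h.cur_le_of_mem y (h.new_mem y hyU (not_le.1 hlt))
    omega
  have hv := h.not_covered_of_compatible (by omega) hle hcomp
  have hchord : chord y (off + x) = (y, off + x) := by
    rw [chord_eq, min_eq_left (by omega), max_eq_right (by omega)]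
  classical
  obtain ⟨S, hS⟩ : ∃ S, S = U.filter fun z => y < z ∧ z < cur ∧ ¬ Covered C₀ z := ⟨_, rfl⟩
  have hSmem : ∀ z ∈ S, z ∈ U ∧ y < z ∧ z < cur ∧ ¬ Covered C₀ z := by
    intro z hz
    rw [hS] at hz
    exact Finset.mem_filter.1 hz
  -- `R` has `min S.card k` elements: either all of `S` is represented, or `k` points are and the
  -- rest is spare.
  obtain ⟨R, hRS, hRcard⟩ := Finset.exists_subset_card_eq (min_le_left S.card k)
  have hRold : ∀ z ∈ R, z ≤ off := by
    intro z hz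
    by_contra hlt
    have h1 := hSmem z (hRS hz)
    have := h.cur_le_of_mem z (h.new_mem z h1.1 (not_le.1 hlt))
    omega
  have hdisj : Disjoint Q R := by
    rw [Finset.disjoint_left]
    intro z hzQ hzR
    have := h.cur_le_of_mem z hzQ
    have := (hSmem z (hRS hzR)).2.2.1
    omega
  obtain ⟨f', hf'⟩ : ∃ f' : ℕ → ℕ, ∀ z, f' z =
      if z < y then 0 else if z = y then t - 2 else if z < cur then t - 1 else f z :=
    ⟨_, fun _ => rfl⟩
  have hf'cur : ∀ z, cur ≤ z → f' z = f z := by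
    intro z hz
    rw [hf', if_neg (by omega), if_neg (by omega), if_neg (by omega)]
  have hf'y : f' y = t - 2 := by
    rw [hf', if_neg (by omega), if_pos rfl]
  have hf'R : ∀ z, y < z → z < cur → f' z = t - 1 := by
    intro z h1 h2
    rw [hf', if_neg (by omega), if_neg (by omega), if_pos h2]
  have hf'x : f' (off + x) = x := by
    rw [hf'cur _ (by omega), h.shift x (by omega)]
  have hmono : Monotone f' := by
    intro a b hab
    have h1 := h.mono hab
    have h2 := h.above b
    rw [hf' a, hf' b]
    split_ifs <;> omega
  have hcompa : compatible Ca (t - 2, x) = true := by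
    rw [compatible_eq_true] at hcomp ⊢
    intro c' hc' hcross
    obtain ⟨c, hc, rfl, hc1, hc2⟩ := h.chords c' hc'
    refine hcomp c hc ?_
    rw [hchord]
    refine crossing_of_crossing_map hmono ?_
    rw [hf'y, hf'x, hf'cur _ hc1, hf'cur _ (hc1.trans hc2)]
    exact hcross
  refine ⟨R.card, f', Q ∪ R, by omega, hcompa, ?_⟩
  exact {
    mono := hmono
    shift := fun v hv' => by rw [hf'cur _ (by omega), h.shift v hv']
    low := fun v hv' => by
      have := h.low v hv'
      rw [hf']
      split_ifs <;> omega
    below := fun v hv' => by rw [hf', if_pos hv']; omega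
    above := fun v hv' => by
      have := h.above v
      rw [hf']
      split_ifs <;> omega
    cur_le := by omega
    room := by omega
    le_start := by omega
    old_le := h.old_le
    old_mem := fun c hc => List.mem_cons_of_mem _ (h.old_mem c hc)
    points := by
      rw [← Finset.disjUnion_eq_union _ _ hdisj, Finset.disjUnion_val, Multiset.map_add,
        Multiset.map_congr rfl fun z hz => hf'cur z (h.cur_le_of_mem z hz), ← h.points,
        Multiset.map_congr rfl fun z hz =>
          hf'R z (hSmem z (hRS hz)).2.1 (hSmem z (hRS hz)).2.2.1, Multiset.map_const',
        ← Multiset.coe_add, Multiset.coe_replicate, add_comm]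
      rfl
    subset := by
      intro v hvQ
      rw [Finset.mem_erase]
      rcases Finset.mem_union.1 hvQ with hvQ | hvR
      · have := h.cur_le_of_mem v hvQ
        exact ⟨by omega, h.subset hvQ⟩
      · have := hSmem v (hRS hvR)
        exact ⟨by omega, this.1⟩
    cur_le_of_mem := by
      intro v hvQ
      rcases Finset.mem_union.1 hvQ with hvQ | hvR
      · have := h.cur_le_of_mem v hvQ
        omega
      · exact (hSmem v (hRS hvR)).2.1.le
    new_gap := fun v hvU => h.new_gap v (Finset.mem_of_mem_erase hvU)
    new_mem := fun v hvU hlt =>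
      Finset.mem_union_left _ (h.new_mem v (Finset.mem_of_mem_erase hvU) hlt)
    visible := by
      intro v hvQ hvle
      rcases Finset.mem_union.1 hvQ with hvQ | hvR
      · exact h.visible v hvQ hvle
      · exact (hSmem v (hRS hvR)).2.2.2
    spare := by
      intro v hvU hyv hvle hvv hvQ
      rw [Finset.mem_erase] at hvU
      rw [Finset.mem_union, not_or] at hvQ
      by_cases hvcur : v < cur
      · have hvS : v ∈ S := by
          rw [hS, Finset.mem_filter]
          exact ⟨hvU.2, by omega, hvcur, hvv⟩
        have hlt : R.card < S.card :=
          Finset.card_lt_card ⟨hRS, fun hSR => hvQ.2 (hSR hvS)⟩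
        have hk : k = R.card := by omega
        rw [hk]
        refine Finset.card_le_card fun z hz => ?_
        have hz' := hSmem z (hRS hz)
        rw [Finset.mem_filter, hf'R z hz'.2.1 hz'.2.2.1, hf'R v (by omega) hvcur]
        exact ⟨Finset.mem_union_right _ hz, rfl⟩
      · have hcard := h.spare v hvU.2 (by omega) hvle hvv hvQ.1
        refine (Nat.le_succ k).trans (hcard.trans (Finset.card_le_card fun z hz => ?_))
        rw [Finset.mem_filter] at hz ⊢
        rw [hf'cur z (h.cur_le_of_mem z hz.1), hf'cur v (by omega)]
        exact ⟨Finset.mem_union_left _ hz.1, hz.2⟩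
    chords := by
      intro c' hc'
      rcases List.mem_cons.1 hc' with rfl | hc'
      · refine ⟨_, List.mem_cons_self, ?_⟩
        rw [hchord, hf'y, hf'x]
        exact ⟨rfl, le_rfl, by dsimp only; omega⟩
      · obtain ⟨c, hc, rfl, hc1, hc2⟩ := h.chords c' hc'
        refine ⟨c, List.mem_cons_of_mem _ hc, ?_, by omega, hc2⟩
        rw [hf'cur _ hc1, hf'cur _ (hc1.trans hc2)]
    weight := by
      have hw := h.weight
      rw [filter_prod_erase hyU hle hv] at hw
      rw [Finset.filter_union, Finset.card_union_of_disjoint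
        (Finset.disjoint_filter_filter hdisj), Finset.filter_true_of_mem hRold]
      rw [pow_succ, pow_add, pow_add]
      linear_combination (6 / 7 : ℝ) ^ R.card * hw }

theorem exists_move (h : Simulates off C₀ w (k + 1) Ua Ca t s U C f cur Q) {x : ℕ} (hx : 16 < x)
    (hxU : off + x ∉ U) (d : Option ℕ) (hd : LegalMove (U, C) (off + x) d) :
    ∃ Ua' Ca' t' s' f' cur' Q', (∀ v, v Ua' Ca' t' s' ≤ moveValue v k Ua Ca t s x) ∧
      Simulates off C₀ w k Ua' Ca' t' s' (move (U, C) (off + x) d).1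
        (move (U, C) (off + x) d).2 f' cur' Q' := by
  cases d with
  | none => exact ⟨_, _, _, _, _, _, _, fun v => leave_le_moveValue v k Ua Ca t s x, h.leave hx hxU⟩
  | some y =>
    obtain ⟨hyU, hcomp⟩ := hd
    by_cases hcur : cur ≤ y
    · obtain ⟨Q', h1, h2, h3⟩ := h.inner hx hyU hcur hcomp
      exact ⟨_, _, _, _, _, _, _, fun v => inner_le_moveValue v k t s h1 h2, h3⟩
    · obtain ⟨r, f', Q', h1, h2, h3⟩ := h.outer hx hyU (not_le.1 hcur) hcomp
      exact ⟨_, _, _, _, _, _, _, fun v => outer_le_moveValue v Ua s h1 h2, h3⟩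

theorem prod_pointWeight (C : List (ℕ × ℕ)) (U : List ℕ) :
    (U.map (pointWeight C)).prod =
      (1 / 3) ^ countCovered C U * (6 / 7) ^ (U.length - countCovered C U) := by
  induction U with
  | nil => simp [countCovered]
  | cons y U ih =>
    have hle := countCovered_le C U
    rw [countCovered_cons, List.map_cons, List.prod_cons, ih, List.length_cons, pointWeight]
    split_ifs
    · rw [Nat.add_sub_add_right, pow_succ]
      ring
    · rw [Nat.sub_add_comm hle, pow_succ]
      ring

/-- Since `126 = 3 * 6 * 7`, the scale `126 ^ 24` makes the leaf values integers. Truncated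
subtraction in the exponents can only enlarge them, whence an inequality. -/
theorem prod_pointWeight_le (C : List (ℕ × ℕ)) (U : List ℕ) (s : ℕ) :
    (U.map (pointWeight C)).prod * 126 ^ 24 ≤ leafWeight U C s * (6 / 7 : ℝ) ^ s := by
  rw [prod_pointWeight, leafWeight, force_eq]
  generalize countCovered C U = a
  generalize U.length - a = v
  push_cast
  have h3 : (1 / 3 : ℝ) ^ a * 3 ^ 24 ≤ 3 ^ (24 - a) := by
    rw [one_div, inv_pow, inv_mul_le_iff₀ (by positivity), ← pow_add]
    exact pow_le_pow_right₀ (by norm_num) (by omega)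
  have h6 : (6 : ℝ) ^ (24 + v) ≤ 6 ^ (24 + v - s) * 6 ^ s := by
    rw [← pow_add]
    exact pow_le_pow_right₀ (by norm_num) (by omega)
  have h7 : (7 : ℝ) ^ (24 + s) ≤ 7 ^ (24 + s - v) * 7 ^ v := by
    rw [← pow_add]
    exact pow_le_pow_right₀ (by norm_num) (by omega)
  have h67 : (6 / 7 : ℝ) ^ v * (6 ^ 24 * 7 ^ 24) ≤
      6 ^ (24 + v - s) * 7 ^ (24 + s - v) * (6 / 7) ^ s := by
    rw [div_pow, div_pow, div_mul_eq_mul_div, mul_div_assoc', div_le_div_iff₀ (by positivity)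
      (by positivity)]
    calc (6 : ℝ) ^ v * (6 ^ 24 * 7 ^ 24) * 7 ^ s = 6 ^ (24 + v) * 7 ^ (24 + s) := by ring
      _ ≤ (6 ^ (24 + v - s) * 6 ^ s) * (7 ^ (24 + s - v) * 7 ^ v) := by gcongr
      _ = _ := by ring
  calc (1 / 3 : ℝ) ^ a * (6 / 7) ^ v * 126 ^ 24
      = ((1 / 3 : ℝ) ^ a * 3 ^ 24) * ((6 / 7) ^ v * (6 ^ 24 * 7 ^ 24)) := by norm_num; ring
    _ ≤ 3 ^ (24 - a) * (6 ^ (24 + v - s) * 7 ^ (24 + s - v) * (6 / 7) ^ s) := by gcongr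
    _ = _ := by ring

/-- Weights of points outside `Q` have only dropped since the start of the block, as chords are
never removed. For a point of `Q`, an abstract chord that covers its image comes from a real chord
that covers the point, so the abstract weight is at least the real one. The invariant `weight`
combines the two parts. -/
theorem potential_le (h : Simulates off C₀ w k Ua Ca t s U C f cur Q) :
    potential (U, C) * 126 ^ 24 ≤ w * leafWeight Ua Ca s := by
  have hsplit : potential (U, C) = (∏ y ∈ U \ Q, pointWeight C y) * ∏ y ∈ Q, pointWeight C y :=
    (Finset.prod_sdiff h.subset).symm
  have hold : U \ Q ⊆ U.filter fun y => y ≤ off := by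
    intro y hy
    rw [Finset.mem_sdiff] at hy
    refine Finset.mem_filter.2 ⟨hy.1, ?_⟩
    by_contra hlt
    exact hy.2 (h.new_mem y hy.1 (not_le.1 hlt))
  have hsdiff : (U.filter fun y => y ≤ off) \ (U \ Q) = Q.filter fun y => y ≤ off := by
    ext y
    simp only [Finset.mem_sdiff, Finset.mem_filter, not_and, not_not]
    exact ⟨fun hy => ⟨hy.2 hy.1.1, hy.1.2⟩, fun hy => ⟨⟨h.subset hy.1, hy.2⟩, fun _ => hy.1⟩⟩
  have hmid := Finset.prod_sdiff hold (f := pointWeight C₀)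
  rw [hsdiff, Finset.prod_congr rfl fun y hy => pointWeight_of_not_covered
    (h.visible y (Finset.mem_filter.1 hy).1 (Finset.mem_filter.1 hy).2), Finset.prod_const] at hmid
  have hw := h.weight
  rw [← hmid] at hw
  have h1 : ∏ y ∈ U \ Q, pointWeight C y ≤ ∏ y ∈ U \ Q, pointWeight C₀ y := by
    refine Finset.prod_le_prod (fun _ _ => (pointWeight_pos _ _).le) fun y _ => ?_
    refine pointWeight_le_pointWeight ?_
    rintro ⟨c, hc, hh⟩
    exact ⟨c, h.old_mem c hc, hh⟩
  have h2 : ∏ y ∈ Q, pointWeight C y ≤ (Ua.map (pointWeight Ca)).prod := by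
    have hprod : (Ua.map (pointWeight Ca)).prod = ∏ y ∈ Q, pointWeight Ca (f y) := by
      rw [← Multiset.prod_coe, ← Multiset.map_coe, h.points, Multiset.map_map]
      rfl
    rw [hprod]
    refine Finset.prod_le_prod (fun _ _ => (pointWeight_pos _ _).le) fun y _ => ?_
    refine pointWeight_le_pointWeight ?_
    rintro ⟨c', hc', hlt, hgt⟩
    obtain ⟨c, hc, rfl, -, -⟩ := h.chords c' hc'
    exact ⟨c, hc, h.mono.reflect_lt hlt, h.mono.reflect_lt hgt⟩
  have h3 := prod_pointWeight_le Ca Ua s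
  have hpos : (0 : ℝ) < (6 / 7) ^ (Q.filter fun y => y ≤ off).card := by positivity
  have hmid' : (∏ y ∈ U \ Q, pointWeight C₀ y) * (6 / 7) ^ s = w := by
    refine mul_left_cancel₀ hpos.ne' ?_
    linear_combination hw
  have hnn : 0 ≤ ∏ y ∈ U \ Q, pointWeight C₀ y :=
    Finset.prod_nonneg fun _ _ => (pointWeight_pos _ _).le
  have hnn' : 0 ≤ ∏ y ∈ Q, pointWeight C y :=
    Finset.prod_nonneg fun _ _ => (pointWeight_pos _ _).le
  rw [hsplit]
  calc (∏ y ∈ U \ Q, pointWeight C y) * (∏ y ∈ Q, pointWeight C y) * 126 ^ 24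
      ≤ (∏ y ∈ U \ Q, pointWeight C₀ y) * (Ua.map (pointWeight Ca)).prod * 126 ^ 24 := by gcongr
    _ = (∏ y ∈ U \ Q, pointWeight C₀ y) * ((Ua.map (pointWeight Ca)).prod * 126 ^ 24) := by ring
    _ ≤ (∏ y ∈ U \ Q, pointWeight C₀ y) * (leafWeight Ua Ca s * (6 / 7 : ℝ) ^ s) := by gcongr
    _ = w * leafWeight Ua Ca s := by
      rw [← hmid']
      ring

end Simulates

/-! ### Bounds for random inputs -/

/-- The sum of `g` over a weighted list of sequences. -/
noncomputable def weightedSum (ls : List (ℕ × List ℕ)) (g : List ℕ → ℝ) : ℝ :=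
  (ls.map fun a => (a.1 : ℝ) * g a.2).sum

theorem weightedSum_le_weightedSum {ls : List (ℕ × List ℕ)} {g g' : List ℕ → ℝ}
    (h : ∀ a ∈ ls, g a.2 ≤ g' a.2) : weightedSum ls g ≤ weightedSum ls g' :=
  List.sum_le_sum fun a ha => mul_le_mul_of_nonneg_left (h a ha) (Nat.cast_nonneg _)

theorem weightedSum_mul (ls : List (ℕ × List ℕ)) (g : List ℕ → ℝ) (c : ℝ) :
    weightedSum ls (fun l => g l * c) = weightedSum ls g * c := by
  simp only [weightedSum, ← mul_assoc, List.sum_map_mul_right]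

theorem sum_le_sum_filter {β : Type} (key : β → ℕ) (h : β → ℝ) (hh : ∀ b, 0 ≤ h b) (L : List ℕ)
    (l : List β) (hl : ∀ b ∈ l, key b ∈ L) :
    (l.map h).sum ≤ (L.map fun x => ((l.filter fun b => Nat.beq (key b) x).map h).sum).sum := by
  induction l with
  | nil => simp
  | cons b l ih =>
    have hb := hl b List.mem_cons_self
    have ih' := ih fun c hc => hl c (List.mem_cons_of_mem _ hc)
    have hsplit : ∀ x, (((b :: l).filter fun b => Nat.beq (key b) x).map h).sum =
        (if key b = x then h b else 0) + ((l.filter fun b => Nat.beq (key b) x).map h).sum := by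
      intro x
      rw [List.filter_cons]
      by_cases hx : key b = x
      · rw [if_pos (by simpa using hx), if_pos hx, List.map_cons, List.sum_cons]
      · rw [if_neg (by simpa using hx), if_neg hx, zero_add]
    simp only [hsplit, List.sum_map_add, List.map_cons, List.sum_cons]
    refine add_le_add ?_ ih'
    refine le_trans ?_ (List.single_le_sum (l := L.map fun x => if key b = x then h b else 0) ?_ _
      (List.mem_map_of_mem hb))
    · simp
    · simp only [List.mem_map]
      rintro _ ⟨x, -, rfl⟩
      split_ifs
      · exact hh b
      · exact le_rfl

theorem weightedSum_le_sum_tails {ls : List (ℕ × List ℕ)} {g : List ℕ → ℝ} (hg : ∀ l, 0 ≤ g l)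
    (hls : ∀ a ∈ ls, a.2 ≠ []) :
    weightedSum ls g ≤
      ((heads ls).map fun x => weightedSum (tails x ls) fun r => g (x :: r)).sum := by
  refine (sum_le_sum_filter (fun a => a.2.headI) (fun a => (a.1 : ℝ) * g a.2)
    (fun a => mul_nonneg (Nat.cast_nonneg _) (hg _)) (heads ls) ls fun a ha => mem_heads ha).trans
    (le_of_eq ?_)
  congr 1
  refine List.map_congr_left fun x _ => ?_
  rw [weightedSum, tails, List.map_map]
  congr 1
  refine List.map_congr_left fun a ha => ?_
  rw [List.mem_filter] at ha
  have hx : a.2.headI = x := by simpa using ha.2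
  have ha' := hls a ha.1
  obtain ⟨c, l⟩ := a
  cases l with
  | nil => exact absurd rfl ha'
  | cons y r =>
    obtain rfl : y = x := hx
    rfl

theorem mem_tails {ls : List (ℕ × List ℕ)} (hls : ∀ a ∈ ls, a.2 ≠ []) {x : ℕ}
    {a : ℕ × List ℕ} (ha : a ∈ tails x ls) : (a.1, x :: a.2) ∈ ls := by
  rw [tails, List.mem_map] at ha
  obtain ⟨⟨c, l⟩, hl, rfl⟩ := ha
  rw [List.mem_filter] at hl
  have hx : l.headI = x := by simpa using hl.2
  have ha' := hls _ hl.1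
  cases l with
  | nil => exact absurd rfl ha'
  | cons y r =>
    obtain rfl : y = x := hx
    exact hl.1

theorem LegalRun.exists_cons {g : Position} {x : ℕ} {l : List ℕ} {D : List (Option ℕ)}
    (h : LegalRun g (x :: l) D) :
    ∃ d D', D = d :: D' ∧ LegalMove g x d ∧ LegalRun (move g x d) l D' := by
  cases D with
  | nil => exact h.elim
  | cons d D' => exact ⟨d, D', rfl, h⟩

theorem notMem_move {g : Position} {x z : ℕ} (d : Option ℕ) (hz : z ∉ g.1) (hzx : z ≠ x) :
    z ∉ (move g x d).1 := by
  cases d with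
  | none => exact fun h => (Finset.mem_insert.1 h).elim hzx hz
  | some y => exact fun h => hz (Finset.mem_of_mem_erase h)

-- Induction on the number of arrivals. Decisions depend only on the prefix seen, so all good
-- sequences beginning with `x` share the first decision, and `moveValue` maximizes over its
-- abstract counterparts. Sequences that are not good count as zero.
open Classical in
theorem weightedSum_potential_le {off : ℕ} {C₀ : List (ℕ × ℕ)} {w : ℝ} (hw : 0 ≤ w) (k : ℕ) :
    ∀ {ls : List (ℕ × List ℕ)} {Ua : List ℕ} {Ca : List (ℕ × ℕ)} {t s : ℕ} {g : Position}
      {f : ℕ → ℕ} {cur : ℕ} {Q : Finset ℕ} {good : List ℕ → Prop} {D : List ℕ → List (Option ℕ)},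
      Simulates off C₀ w k Ua Ca t s g.1 g.2 f cur Q →
      (∀ a ∈ ls, a.2.length = k ∧ a.2.Nodup ∧ ∀ x ∈ a.2, 16 < x ∧ off + x ∉ g.1) →
      (∀ a ∈ ls, good a.2 → LegalRun g (a.2.map (off + ·)) (D a.2)) →
      (∀ a ∈ ls, ∀ b ∈ ls, good a.2 → good b.2 → ∀ m, a.2.take m = b.2.take m →
        (D a.2).take m = (D b.2).take m) →
      weightedSum ls (fun l => if good l then potential (run g (l.map (off + ·)) (D l)) else 0) *
        126 ^ 24 ≤ w * gameValue k ls Ua Ca t s := by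
  induction k with
  | zero =>
    intro ls Ua Ca t s g f cur Q good D hsim hls hlegal hD
    have hpot := hsim.potential_le
    rw [gameValue_zero, ← weightedSum_mul]
    push_cast
    rw [mul_left_comm, ← List.sum_map_mul_right, List.map_map]
    refine List.sum_le_sum fun a ha => mul_le_mul_of_nonneg_left ?_ (Nat.cast_nonneg _)
    rw [List.length_eq_zero_iff.1 (hls a ha).1]
    dsimp only
    split_ifs
    · exact hpot
    · rw [zero_mul]
      positivity
  | succ k ih =>
    intro ls Ua Ca t s g f cur Q good D hsim hls hlegal hD
    have hne : ∀ a ∈ ls, a.2 ≠ [] := fun a ha hnil => by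
      have := (hls a ha).1
      simp [hnil] at this
    have hnonneg : ∀ l, 0 ≤ if good l then potential (run g (l.map (off + ·)) (D l)) else 0 := by
      intro l
      split_ifs
      · exact (potential_pos _).le
      · exact le_rfl
    refine (mul_le_mul_of_nonneg_right (weightedSum_le_sum_tails hnonneg hne)
      (by positivity)).trans ?_
    rw [gameValue_succ]
    push_cast
    rw [← List.sum_map_mul_right, List.map_map, ← List.sum_map_mul_left]
    refine List.sum_le_sum fun x _ => ?_
    by_cases hx : ∃ a ∈ tails x ls, good (x :: a.2)
    · obtain ⟨a₀, ha₀, hgood₀⟩ := hx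
      have hmem₀ := mem_tails hne ha₀
      obtain ⟨d, D₀, hDd, hmove, -⟩ := (hlegal _ hmem₀ hgood₀).exists_cons
      have hDcons : ∀ a ∈ tails x ls, good (x :: a.2) →
          D (x :: a.2) = d :: (D (x :: a.2)).tail := by
        intro a ha hgood
        obtain ⟨d', D', hD', -, -⟩ := (hlegal _ (mem_tails hne ha) hgood).exists_cons
        have := hD _ (mem_tails hne ha) _ hmem₀ hgood hgood₀ 1 (by simp)
        dsimp only at this hD' hDd
        rw [hD', hDd] at this
        rw [hD', show d' = d by simpa using this]
        rfl
      have hx16 := (hls _ hmem₀).2.2 x List.mem_cons_self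
      obtain ⟨Ua', Ca', t', s', f', cur', Q', hle, hsim'⟩ := hsim.exists_move hx16.1 hx16.2 d hmove
      refine le_trans ?_ (mul_le_mul_of_nonneg_left (Nat.cast_le.2
        (hle (gameValue k (tails x ls)))) hw)
      refine le_trans (mul_le_mul_of_nonneg_right (weightedSum_le_weightedSum fun a ha => ?_)
        (by positivity)) (ih (good := fun r => good (x :: r)) (D := fun r => (D (x :: r)).tail)
          hsim' ?_ ?_ ?_)
      · split_ifs with hgood
        · rw [hDcons a ha hgood]
          exact le_rfl
        · exact le_rfl
      · intro a ha
        obtain ⟨h1, h2, h3⟩ := hls _ (mem_tails hne ha)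
        rw [List.nodup_cons] at h2
        refine ⟨by simpa using h1, h2.2, fun z hz => ?_⟩
        have hz' := h3 z (List.mem_cons_of_mem _ hz)
        refine ⟨hz'.1, notMem_move d hz'.2 fun h => h2.1 ?_⟩
        rwa [← Nat.add_left_cancel h]
      · intro a ha hgood
        have := hlegal _ (mem_tails hne ha) hgood
        dsimp only at this
        rw [hDcons a ha hgood] at this
        exact this.2
      · intro a ha b hb hga hgb m hm
        have := hD _ (mem_tails hne ha) _ (mem_tails hne hb) hga hgb (m + 1) (by simp [hm])
        dsimp only at this
        rw [hDcons a ha hga, hDcons b hb hgb] at this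
        simpa using this
    · have hzero : weightedSum (tails x ls) (fun r => if good (x :: r) then
          potential (run g ((x :: r).map (off + ·)) (D (x :: r))) else 0) ≤
          weightedSum (tails x ls) fun _ => 0 := by
        refine weightedSum_le_weightedSum fun a ha => ?_
        rw [if_neg fun hgood => hx ⟨a, ha, hgood⟩]
      have hzero' : weightedSum (tails x ls) (fun _ => 0) = 0 := by simp [weightedSum]
      rw [hzero'] at hzero
      refine (mul_nonpos_of_nonpos_of_nonneg hzero (by positivity)).trans ?_
      simp only [Function.comp_apply]
      positivity

/-! ### Sequences of blocks -/

/-- The admissible blocks: their sequences have a common length, which is at most six, and their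
entries are distinct and bounded. -/
def IsBlock (B : List (ℕ × List ℕ)) : Prop :=
  ∀ a ∈ B, a.2.length = B.headI.2.length ∧ a.2.length ≤ 6 ∧ a.2.Nodup ∧ ∀ x ∈ a.2, 16 < x ∧ x < 128

/-- An upper bound for the factor by which a block changes the potential, times the total weight. -/
noncomputable def blockValue (B : List (ℕ × List ℕ)) : ℝ :=
  gameValue B.headI.2.length B [] [] 14 0 / 126 ^ 24

/-- The sum over the products of weighted lists. -/
noncomputable def total : List (List (ℕ × List ℕ)) → (List (List ℕ) → ℝ) → ℝ
  | [], f => f []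
  | B :: bs, f => weightedSum B fun l => total bs fun r => f (l :: r)

/-- The concatenation of sequences, shifted such that they follow each other. -/
def place : ℕ → List (List ℕ) → List ℕ
  | _, [] => []
  | off, l :: r => l.map (off + ·) ++ place (off + 128) r

/-- The sequences that a list of blocks can produce. -/
def Support (bs : List (List (ℕ × List ℕ))) (ω : List (List ℕ)) : Prop :=
  List.Forall₂ (fun B l => ∃ c, (c, l) ∈ B) bs ω

theorem total_le_total {bs : List (List (ℕ × List ℕ))} {f g : List (List ℕ) → ℝ}
    (h : ∀ ω, Support bs ω → f ω ≤ g ω) : total bs f ≤ total bs g := by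
  induction bs generalizing f g with
  | nil => exact h [] List.Forall₂.nil
  | cons B bs ih =>
    exact weightedSum_le_weightedSum fun a ha => ih fun ω hω =>
      h _ (List.Forall₂.cons ⟨a.1, ha⟩ hω)

theorem total_zero (bs : List (List (ℕ × List ℕ))) : total bs (fun _ => 0) = 0 := by
  induction bs with
  | nil => rfl
  | cons B bs ih => simp [total, ih, weightedSum]

theorem run_append (g : Position) (l₁ l₂ : List ℕ) (D : List (Option ℕ))
    (h : LegalRun g (l₁ ++ l₂) D) :
    LegalRun g l₁ (D.take l₁.length) ∧
      LegalRun (run g l₁ (D.take l₁.length)) l₂ (D.drop l₁.length) ∧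
      run g (l₁ ++ l₂) D = run (run g l₁ (D.take l₁.length)) l₂ (D.drop l₁.length) := by
  induction l₁ generalizing g D with
  | nil => exact ⟨trivial, h, rfl⟩
  | cons x l₁ ih =>
    obtain ⟨d, D', rfl, hd, hD'⟩ := LegalRun.exists_cons h
    obtain ⟨h1, h2, h3⟩ := ih _ _ hD'
    exact ⟨⟨hd, h1⟩, h2, h3⟩

/-- All points and chords of the position are bounded by `b`. -/
def Position.BoundedBy (g : Position) (b : ℕ) : Prop :=
  (∀ y ∈ g.1, y ≤ b) ∧ ∀ c ∈ g.2, c.2 ≤ b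

theorem Position.BoundedBy.move {g : Position} {b x : ℕ} {d : Option ℕ} (hg : g.BoundedBy b)
    (hx : x ≤ b) (hd : LegalMove g x d) : Position.BoundedBy (move g x d) b := by
  cases d with
  | none =>
    refine ⟨fun y hy => ?_, hg.2⟩
    rcases Finset.mem_insert.1 hy with rfl | hy
    · exact hx
    · exact hg.1 y hy
  | some z =>
    refine ⟨fun y hy => hg.1 y (Finset.mem_of_mem_erase hy), fun c hc => ?_⟩
    rcases List.mem_cons.1 hc with rfl | hc
    · rw [chord_eq]
      exact max_le (hg.1 z hd.1) hx
    · exact hg.2 c hc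

theorem Position.BoundedBy.run {g : Position} {b : ℕ} {l : List ℕ} {D : List (Option ℕ)}
    (hg : g.BoundedBy b) (hl : ∀ x ∈ l, x ≤ b) (hD : LegalRun g l D) :
    Position.BoundedBy (run g l D) b := by
  induction l generalizing g D with
  | nil => exact hg
  | cons x l ih =>
    obtain ⟨d, D', rfl, hd, hD'⟩ := LegalRun.exists_cons hD
    exact ih (hg.move (hl x List.mem_cons_self) hd) (fun z hz => hl z (List.mem_cons_of_mem _ hz))
      hD'

open Classical in
theorem weightedSum_potential_le_blockValue {B : List (ℕ × List ℕ)} (hB : IsBlock B) {off : ℕ}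
    {g : Position} (hg : g.BoundedBy off) {good : List ℕ → Prop}
    {D : List ℕ → List (Option ℕ)}
    (hlegal : ∀ a ∈ B, good a.2 → LegalRun g (a.2.map (off + ·)) (D a.2))
    (hD : ∀ a ∈ B, ∀ b ∈ B, good a.2 → good b.2 → ∀ m, a.2.take m = b.2.take m →
      (D a.2).take m = (D b.2).take m) :
    weightedSum B (fun l => if good l then potential (run g (l.map (off + ·)) (D l)) else 0) ≤
      potential g * blockValue B := by
  cases B with
  | nil =>
    simp only [weightedSum, blockValue, List.map_nil, List.sum_nil]
    have := potential_pos g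
    positivity
  | cons a B =>
    have hk : a.2.length ≤ 6 := (hB a List.mem_cons_self).2.1
    have h := weightedSum_potential_le (potential_pos g).le a.2.length
      (ls := a :: B) (good := good) (D := D) (Simulates.start hk hg.1 hg.2) (fun b hb => ?_)
      hlegal hD
    · rw [blockValue, mul_div_assoc', le_div_iff₀ (by positivity)]
      exact h
    · obtain ⟨h1, -, h3, h4⟩ := hB b hb
      refine ⟨h1, h3, fun x hx => ⟨(h4 x hx).1, fun hmem => ?_⟩⟩
      have := hg.1 _ hmem
      have := (h4 x hx).1
      omega

-- The block factors multiply: conditionally on the first block, the remaining blocks form the same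
-- problem from the new position.
open Classical in
theorem total_potential_le {bs : List (List (ℕ × List ℕ))} (hbs : ∀ B ∈ bs, IsBlock B) :
    ∀ {off : ℕ} {g : Position} {good : List (List ℕ) → Prop}
      {D : List (List ℕ) → List (Option ℕ)}, g.BoundedBy off →
      (∀ ω, Support bs ω → good ω → LegalRun g (place off ω) (D ω)) →
      (∀ ω ω', Support bs ω → Support bs ω' → good ω → good ω' →
        ∀ m, (place off ω).take m = (place off ω').take m → (D ω).take m = (D ω').take m) →
      total bs (fun ω => if good ω then potential (run g (place off ω) (D ω)) else 0) ≤
        potential g * (bs.map blockValue).prod := by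
  induction bs with
  | nil =>
    intro off g good D _ _ _
    have := potential_pos g
    simp only [total, place, run, List.map_nil, List.prod_nil, mul_one]
    split_ifs
    · exact le_rfl
    · exact this.le
  | cons B bs ih =>
    intro off g good D hg hlegal hD
    have hB := hbs B List.mem_cons_self
    have hlen : ∀ l c, (c, l) ∈ B → l.length = B.headI.2.length := fun l c h => (hB _ h).1
    set k := B.headI.2.length with hk
    let good₁ : List ℕ → Prop := fun l => ∃ r, Support bs r ∧ good (l :: r)
    -- The decisions in the first block do not depend on the later blocks, so any good continuation
    -- may be used to read them off.
    let D₁ : List ℕ → List (Option ℕ) := fun l =>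
      if h : good₁ l then (D (l :: h.choose)).take k else []
    have hsupp : ∀ {l c r}, (c, l) ∈ B → Support bs r → Support (B :: bs) (l :: r) :=
      fun h h' => List.Forall₂.cons ⟨_, h⟩ h'
    have hD₁ : ∀ {l c r}, (c, l) ∈ B → Support bs r → good (l :: r) →
        D₁ l = (D (l :: r)).take k := by
      intro l c r hl hr hgood
      have hex : good₁ l := ⟨r, hr, hgood⟩
      simp only [D₁, dif_pos hex]
      refine hD _ _ (hsupp hl hex.choose_spec.1) (hsupp hl hr) hex.choose_spec.2 hgood k ?_
      simp only [place]
      rw [List.take_left' (by rw [List.length_map, hlen l c hl]),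
        List.take_left' (by rw [List.length_map, hlen l c hl])]
    have hprod : 0 ≤ (bs.map blockValue).prod := by
      refine List.prod_nonneg fun v hv => ?_
      obtain ⟨B', -, rfl⟩ := List.mem_map.1 hv
      unfold blockValue
      positivity
    have hblock := weightedSum_potential_le_blockValue hB hg (good := good₁) (D := D₁) ?_ ?_
    · rw [List.map_cons, List.prod_cons, ← mul_assoc]
      refine le_trans ?_ (mul_le_mul_of_nonneg_right hblock hprod)
      rw [← weightedSum_mul]
      refine weightedSum_le_weightedSum fun a ha => ?_
      by_cases hgood₁ : good₁ a.2
      · rw [if_pos hgood₁]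
        obtain ⟨r₀, hr₀, hgood₀⟩ := hgood₁
        have hsplit : ∀ r, Support bs r → good (a.2 :: r) →
            LegalRun g (a.2.map (off + ·)) (D₁ a.2) ∧
            LegalRun (run g (a.2.map (off + ·)) (D₁ a.2)) (place (off + 128) r)
              ((D (a.2 :: r)).drop k) ∧
            run g (place off (a.2 :: r)) (D (a.2 :: r)) =
              run (run g (a.2.map (off + ·)) (D₁ a.2)) (place (off + 128) r)
                ((D (a.2 :: r)).drop k) := by
          intro r hr hgood
          have h := run_append g (a.2.map (off + ·)) (place (off + 128) r) (D (a.2 :: r))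
            (hlegal _ (hsupp ha hr) hgood)
          rw [List.length_map, hlen a.2 a.1 ha, ← hD₁ ha hr hgood] at h
          exact h
        refine le_trans (total_le_total fun r hr => ?_) (ih
          (fun B' hB' => hbs B' (List.mem_cons_of_mem _ hB')) (off := off + 128)
          (good := fun r => good (a.2 :: r)) (D := fun r => (D (a.2 :: r)).drop k) ?_
          (fun r hr hgood => (hsplit r hr hgood).2.1) ?_)
        · dsimp only
          split_ifs with hgood
          · rw [(hsplit r hr hgood).2.2]
          · exact le_rfl
        · refine Position.BoundedBy.run ⟨fun y hy => ?_, fun c hc => ?_⟩ (fun x hx => ?_)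
            (hsplit r₀ hr₀ hgood₀).1
          · have := hg.1 y hy
            omega
          · have := hg.2 c hc
            omega
          · obtain ⟨z, hz, rfl⟩ := List.mem_map.1 hx
            have := ((hB a ha).2.2.2 z hz).2
            omega
        · intro r r' hr hr' hgood hgood' m hm
          have h := hD _ _ (hsupp ha hr) (hsupp ha hr') hgood hgood' (k + m) ?_
          · rw [List.take_drop, List.take_drop, h]
          · simp only [place]
            rw [← hlen a.2 a.1 ha, ← List.length_map (off + ·), List.take_length_add_append,
              List.take_length_add_append, hm]
      · rw [if_neg hgood₁, zero_mul]
        refine (total_le_total fun r hr => ?_).trans (total_zero bs).le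
        exact (if_neg fun hgood => hgood₁ ⟨r, hr, hgood⟩).le
    · rintro a ha ⟨r, hr, hgood⟩
      have h := run_append g (a.2.map (off + ·)) (place (off + 128) r) (D (a.2 :: r))
        (hlegal _ (hsupp ha hr) hgood)
      rw [List.length_map, hlen a.2 a.1 ha, ← hD₁ ha hr hgood] at h
      exact h.1
    · rintro a ha b hb ⟨r, hr, hgood⟩ ⟨r', hr', hgood'⟩ m hm
      rw [hD₁ ha hr hgood, hD₁ hb hr' hgood', List.take_take, List.take_take]
      refine hD _ _ (hsupp ha hr) (hsupp hb hr') hgood hgood' (min m k) ?_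
      simp only [place]
      have hla : a.2.length = k := hlen a.2 a.1 ha
      have hlb : b.2.length = k := hlen b.2 b.1 hb
      rw [List.take_append_of_le_length (by rw [List.length_map, hla]; exact min_le_right _ _),
        List.take_append_of_le_length (by rw [List.length_map, hlb]; exact min_le_right _ _),
        ← List.map_take, ← List.map_take, ← List.take_take, ← List.take_take,
        List.take_of_length_le hla.le, List.take_of_length_le hlb.le, hm]

/-! ### Runs of an algorithm as runs on positions -/

/-- One step of an algorithm on points with the coordinates `Xs`, located in the plane by `loc`. A
state consists of the number of served points, the number of bits read, and the decisions. -/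
def traceStep (A : Algorithm) (t : Tape) (loc : ℕ → Plane) (Xs : List ℕ)
    (s : ℕ × ℕ × List (Option ℕ)) : ℕ × ℕ × List (Option ℕ) :=
  match A ((Xs.take (s.1 + 1)).map loc) (t.prefixBits s.2.1) with
  | Command.readBit => (s.1, s.2.1 + 1, s.2.2)
  | Command.leave => (s.1 + 1, s.2.1, s.2.2 ++ [none])
  -- The default 0 plays no role in admissible runs, where `j` is the number of an earlier point.
  | Command.matchWith j => (s.1 + 1, s.2.1, s.2.2 ++ [some ((Xs.take (s.1 + 1)).getD j 0)])

/-- The state after `n` steps. -/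
def trace (A : Algorithm) (t : Tape) (loc : ℕ → Plane) (Xs : List ℕ) :
    ℕ → ℕ × ℕ × List (Option ℕ)
  | 0 => (0, 0, [])
  | n + 1 => traceStep A t loc Xs (trace A t loc Xs n)

variable {A : Algorithm} {t : Tape} {loc : ℕ → Plane}

theorem traceStep_cases (A : Algorithm) (t : Tape) (loc : ℕ → Plane) (Xs : List ℕ)
    (s : ℕ × ℕ × List (Option ℕ)) :
    ((traceStep A t loc Xs s).1 = s.1 ∧ (traceStep A t loc Xs s).2.2 = s.2.2) ∨
      ((traceStep A t loc Xs s).1 = s.1 + 1 ∧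
        ∃ d, (traceStep A t loc Xs s).2.2 = s.2.2 ++ [d]) := by
  unfold traceStep
  split
  · exact Or.inl ⟨rfl, rfl⟩
  · exact Or.inr ⟨rfl, _, rfl⟩
  · exact Or.inr ⟨rfl, _, rfl⟩

theorem length_trace (A : Algorithm) (t : Tape) (loc : ℕ → Plane) (Xs : List ℕ) (n : ℕ) :
    (trace A t loc Xs n).2.2.length = (trace A t loc Xs n).1 := by
  induction n with
  | zero => rfl
  | succ n ih =>
    rcases traceStep_cases A t loc Xs (trace A t loc Xs n) with h | ⟨h, d, hd⟩
    · rw [trace, h.1, h.2, ih]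
    · rw [trace, h, hd, List.length_append, ih, List.length_singleton]

theorem trace_prefix_succ (A : Algorithm) (t : Tape) (loc : ℕ → Plane) (Xs : List ℕ) (n : ℕ) :
    (trace A t loc Xs n).2.2 <+: (trace A t loc Xs (n + 1)).2.2 := by
  rcases traceStep_cases A t loc Xs (trace A t loc Xs n) with h | ⟨-, d, hd⟩
  · rw [trace, h.2]
  · rw [trace, hd]
    exact List.prefix_append _ _

theorem trace_prefix (A : Algorithm) (t : Tape) (loc : ℕ → Plane) (Xs : List ℕ) {n n' : ℕ}
    (h : n ≤ n') : (trace A t loc Xs n).2.2 <+: (trace A t loc Xs n').2.2 := by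
  induction h with
  | refl => exact List.prefix_rfl
  | step _ ih => exact ih.trans (trace_prefix_succ A t loc Xs _)

theorem take_eq_of_prefix {β : Type} {l l' : List β} {m : ℕ} (h : l <+: l') (hm : m ≤ l.length) :
    l.take m = l'.take m := by
  obtain ⟨r, rfl⟩ := h
  rw [List.take_append_of_le_length hm]

/-- With the same tape, two inputs with a common prefix of length `m` produce identical states until
`m` points are served; after that the first `m` decisions are frozen. -/
theorem trace_agree {Xs Xs' : List ℕ} {m : ℕ} (h : Xs.take m = Xs'.take m) (n : ℕ) :
    trace A t loc Xs n = trace A t loc Xs' n ∨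
      (m ≤ (trace A t loc Xs n).1 ∧ m ≤ (trace A t loc Xs' n).1 ∧
        (trace A t loc Xs n).2.2.take m = (trace A t loc Xs' n).2.2.take m) := by
  induction n with
  | zero => exact Or.inl rfl
  | succ n ih =>
    by_cases hlt : trace A t loc Xs n = trace A t loc Xs' n ∧ (trace A t loc Xs n).1 < m
    · left
      have hX : Xs.take ((trace A t loc Xs' n).1 + 1) = Xs'.take ((trace A t loc Xs' n).1 + 1) := by
        have hm : (trace A t loc Xs n).1 + 1 ≤ m := hlt.2
        rw [← hlt.1, ← min_eq_left hm, ← List.take_take, h, List.take_take]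
      rw [trace, trace, hlt.1, traceStep, traceStep, hX]
    · right
      have ih' : m ≤ (trace A t loc Xs n).1 ∧ m ≤ (trace A t loc Xs' n).1 ∧
          (trace A t loc Xs n).2.2.take m = (trace A t loc Xs' n).2.2.take m := by
        rcases ih with heq | ih
        · have hm : m ≤ (trace A t loc Xs n).1 := not_lt.1 fun hlt' => hlt ⟨heq, hlt'⟩
          exact ⟨hm, heq ▸ hm, by rw [heq]⟩
        · exact ih
      obtain ⟨h1, h2, h3⟩ := ih'
      rw [← length_trace] at h1 h2
      have h4 := trace_prefix_succ A t loc Xs n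
      have h5 := trace_prefix_succ A t loc Xs' n
      rw [← length_trace, ← length_trace, ← take_eq_of_prefix h4 h1, ← take_eq_of_prefix h5 h2]
      exact ⟨h1.trans h4.length_le, h2.trans h5.length_le, h3⟩

/-- The step counts may differ because different numbers of bits may be read. The decision lists
only grow, so the later state can be compared with the earlier one. -/
theorem take_trace_eq {Xs Xs' : List ℕ} {m n n' : ℕ} (h : Xs.take m = Xs'.take m)
    (hlen : (trace A t loc Xs n).1 = (trace A t loc Xs' n').1) :
    (trace A t loc Xs n).2.2.take m = (trace A t loc Xs' n').2.2.take m := by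
  have key : ∀ {Xs Xs' : List ℕ} {n n' : ℕ}, Xs.take m = Xs'.take m → n ≤ n' →
      (trace A t loc Xs n).1 = (trace A t loc Xs' n').1 →
      (trace A t loc Xs n).2.2.take m = (trace A t loc Xs' n').2.2.take m := by
    intro Xs Xs' n n' h hn hlen
    have hp := trace_prefix A t loc Xs' hn
    rcases trace_agree (A := A) (t := t) (loc := loc) h n with heq | ⟨-, h2, h3⟩
    · rw [heq] at hlen ⊢
      rw [← length_trace, ← length_trace] at hlen
      rw [hp.eq_of_length hlen]
    · rw [h3]
      exact take_eq_of_prefix hp (h2.trans (length_trace A t loc Xs' n).ge)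
  rcases le_total n n' with hn | hn
  · exact key h hn hlen
  · exact (key h.symm hn hlen.symm).symm

theorem prefixBits_congr {t t' : Tape} {b : ℕ} (h : ∀ k < b, t k = t' k) :
    t.prefixBits b = t'.prefixBits b :=
  List.map_congr_left fun k hk => h k (List.mem_range.1 hk)

theorem Reaches.congr_tape {N : ℕ} {t t' : Tape} {p : Fin N → Plane} {i b : ℕ}
    {M : Finset (Fin N × Fin N)} (h : Reaches A t p i b M) :
    (∀ k < b, t k = t' k) → Reaches A t' p i b M := by
  induction h with
  | start => exact fun _ => Reaches.start
  | readBit _ hi hc ih =>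
    intro ht
    have ht' := fun k hk => ht k (Nat.lt_succ_of_lt hk)
    exact (ih ht').readBit hi (prefixBits_congr ht' ▸ hc)
  | leave _ hi hc ih => exact fun ht => (ih ht).leave hi (prefixBits_congr ht ▸ hc)
  | matchWith _ hi hc hj hfree hcross ih =>
    exact fun ht => (ih ht).matchWith hi (prefixBits_congr ht ▸ hc) hj hfree hcross

theorem run_concat {g : Position} {l : List ℕ} {D : List (Option ℕ)} (x : ℕ) (d : Option ℕ)
    (h : LegalRun g l D) (hd : LegalMove (run g l D) x d) :
    LegalRun g (l ++ [x]) (D ++ [d]) ∧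
      run g (l ++ [x]) (D ++ [d]) = move (run g l D) x d := by
  induction l generalizing g D with
  | nil =>
    cases D with
    | nil => exact ⟨⟨hd, trivial⟩, rfl⟩
    | cons d D => exact h.elim
  | cons y l ih =>
    obtain ⟨d', D', rfl, hd', hD'⟩ := h.exists_cons
    obtain ⟨h1, h2⟩ := ih hD' hd
    exact ⟨⟨hd', h1⟩, h2⟩

/-- Transfers a run in the plane to the game. Only one direction of the geometry is needed: chords
that interleave do meet, so an admissible match is a legal move. The step count is `i + b`, because
each step serves a point or reads a bit. The last clause yields the parity of the number of free
points. -/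
theorem Reaches.exists_run {N : ℕ} {X : Fin N → ℕ} (hX : Function.Injective X)
    (hloc : ∀ a b c d : ℕ, crossing (chord a b) (chord c d) = true →
      ¬ Disjoint (segment ℝ (loc c) (loc d)) (segment ℝ (loc a) (loc b)))
    {i b : ℕ} {M : Finset (Fin N × Fin N)} (h : Reaches A t (fun k => loc (X k)) i b M) :
    (∀ e ∈ M, (e.1 : ℕ) < i ∧ (e.2 : ℕ) < i) ∧
    ∃ D, trace A t loc (List.ofFn X) (i + b) = (i, b, D) ∧
      LegalRun (∅, []) ((List.ofFn X).take i) D ∧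
      (∀ y, y ∈ (run (∅, []) ((List.ofFn X).take i) D).1 ↔
        ∃ k : Fin N, (k : ℕ) < i ∧ IsFree M k ∧ X k = y) ∧
      (∀ c ∈ (run (∅, []) ((List.ofFn X).take i) D).2, ∃ e ∈ M, c = chord (X e.1) (X e.2)) ∧
      (run (∅, []) ((List.ofFn X).take i) D).1.card +
        2 * (run (∅, []) ((List.ofFn X).take i) D).2.length = i := by
  have hpts : ∀ m, firstPoints (fun k => loc (X k)) m = ((List.ofFn X).take m).map loc := by
    intro m
    rw [firstPoints, List.map_take, List.map_ofFn]
    rfl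
  have hsnoc : ∀ {i} (hi : i < N), (List.ofFn X).take (i + 1) =
      (List.ofFn X).take i ++ [X ⟨i, hi⟩] := by
    intro i hi
    rw [List.take_succ_eq_append_getElem (by simpa using hi), List.getElem_ofFn]
  induction h with
  | start =>
    refine ⟨by simp, [], rfl, trivial, ?_, ?_, rfl⟩
    · simp [run]
    · simp [run]
  | @readBit i b M _ hi hc ih =>
    obtain ⟨hM, D, htr, hrest⟩ := ih
    rw [hpts] at hc
    refine ⟨hM, D, ?_, hrest⟩
    rw [← add_assoc, trace, htr, traceStep]
    dsimp only
    rw [hc]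
  | @leave i b M _ hi hc ih =>
    obtain ⟨hM, D, htr, hrun, hmem, hchord, hcard⟩ := ih
    rw [hpts] at hc
    obtain ⟨h1, h2⟩ := run_concat (X ⟨i, hi⟩) none hrun trivial
    have hfresh : X ⟨i, hi⟩ ∉ (run (∅, []) ((List.ofFn X).take i) D).1 := by
      rw [hmem]
      rintro ⟨k, hk, -, hXk⟩
      rw [hX hXk] at hk
      exact lt_irrefl _ hk
    refine ⟨fun e he => ⟨(hM e he).1.trans (Nat.lt_succ_self i), (hM e he).2.trans
      (Nat.lt_succ_self i)⟩, D ++ [none], ?_, ?_⟩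
    · rw [show i + 1 + b = (i + b) + 1 by ring, trace, htr, traceStep]
      dsimp only
      rw [hc]
    rw [hsnoc hi, h2]
    refine ⟨h1, fun y => ?_, hchord, ?_⟩
    · simp only [move, Finset.mem_insert, hmem]
      constructor
      · rintro (rfl | ⟨k, hk, hfree, rfl⟩)
        · refine ⟨⟨i, hi⟩, Nat.lt_succ_self i, fun e he => ⟨?_, ?_⟩, rfl⟩
          · rintro h
            have := (hM e he).1
            rw [h] at this
            exact lt_irrefl _ this
          · rintro h
            have := (hM e he).2
            rw [h] at this
            exact lt_irrefl _ this
        · exact ⟨k, hk.trans (Nat.lt_succ_self i), hfree, rfl⟩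
      · rintro ⟨k, hk, hfree, rfl⟩
        rcases Nat.lt_succ_iff_lt_or_eq.1 hk with hk | hk
        · exact Or.inr ⟨k, hk, hfree, rfl⟩
        · exact Or.inl (congrArg X (Fin.ext hk))
    · simp only [move, Finset.card_insert_of_notMem hfresh]
      omega
  | @matchWith i b j M _ hi hc hj hfree hcross ih =>
    obtain ⟨hM, D, htr, hrun, hmem, hchord, hcard⟩ := ih
    rw [hpts] at hc
    have hmemj : X ⟨j, hj.trans hi⟩ ∈ (run (∅, []) ((List.ofFn X).take i) D).1 :=
      (hmem _).2 ⟨_, hj, hfree, rfl⟩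
    have hlegal : LegalMove (run (∅, []) ((List.ofFn X).take i) D) (X ⟨i, hi⟩)
        (some (X ⟨j, hj.trans hi⟩)) := by
      refine ⟨hmemj, compatible_eq_true.2 fun c hc' hcr => ?_⟩
      obtain ⟨e, he, rfl⟩ := hchord c hc'
      exact hloc _ _ _ _ hcr (hcross e he)
    obtain ⟨h1, h2⟩ := run_concat (X ⟨i, hi⟩) _ hrun hlegal
    refine ⟨fun e he => ?_, D ++ [some (X ⟨j, hj.trans hi⟩)], ?_, ?_⟩
    · rcases Finset.mem_insert.1 he with rfl | he
      · exact ⟨hj.trans (Nat.lt_succ_self i), Nat.lt_succ_self i⟩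
      · exact ⟨(hM e he).1.trans (Nat.lt_succ_self i), (hM e he).2.trans (Nat.lt_succ_self i)⟩
    · have hget : ((List.ofFn X).take (i + 1)).getD j 0 = X ⟨j, hj.trans hi⟩ := by
        rw [List.getD_eq_getElem _ _ (by simp; omega), List.getElem_take, List.getElem_ofFn]
      rw [show i + 1 + b = (i + b) + 1 by ring, trace, htr, traceStep]
      dsimp only
      rw [hc]
      dsimp only
      rw [hget]
    rw [hsnoc hi, h2]
    refine ⟨h1, fun y => ?_, fun c hc' => ?_, ?_⟩
    · simp only [move, Finset.mem_erase, hmem]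
      constructor
      · rintro ⟨hne, k, hk, hk', rfl⟩
        refine ⟨k, hk.trans (Nat.lt_succ_self i), fun e he => ?_, rfl⟩
        rcases Finset.mem_insert.1 he with rfl | he
        · refine ⟨fun h => hne (congrArg X h.symm), fun h => ?_⟩
          rw [← h] at hk
          exact lt_irrefl _ hk
        · exact hk' e he
      · rintro ⟨k, hk, hk', rfl⟩
        have hji := hk' _ (Finset.mem_insert_self _ _)
        refine ⟨fun h => hji.1 (hX h).symm, k, ?_, fun e he =>
          hk' e (Finset.mem_insert_of_mem he), rfl⟩
        rcases Nat.lt_succ_iff_lt_or_eq.1 hk with hk | hk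
        · exact hk
        · exact absurd (Fin.ext hk).symm hji.2
    · rcases List.mem_cons.1 hc' with rfl | hc'
      · exact ⟨_, Finset.mem_insert_self _ _, rfl⟩
      · obtain ⟨e, he, hce⟩ := hchord c hc'
        exact ⟨e, Finset.mem_insert_of_mem he, hce⟩
    · have hpos := Finset.card_pos.2 ⟨_, hmemj⟩
      simp only [move, Finset.card_erase_of_mem hmemj, List.length_cons]
      omega

theorem Outcome.exists_run {N : ℕ} {X : Fin N → ℕ} (hX : Function.Injective X)
    (hloc : ∀ a b c d : ℕ, crossing (chord a b) (chord c d) = true →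
      ¬ Disjoint (segment ℝ (loc c) (loc d)) (segment ℝ (loc a) (loc b)))
    {b : ℕ} {M : Finset (Fin N × Fin N)} (h : Outcome A t (fun k => loc (X k)) b M) :
    ∃ D, trace A t loc (List.ofFn X) (N + b) = (N, b, D) ∧ LegalRun (∅, []) (List.ofFn X) D ∧
      (run (∅, []) (List.ofFn X) D).1.card = numUnmatched M ∧
      ∃ c, (run (∅, []) (List.ofFn X) D).1.card + 2 * c = N := by
  obtain ⟨-, D, htr, hrun, hmem, -, hcard⟩ := Reaches.exists_run hX hloc h
  rw [List.take_of_length_le (by simp)] at hrun hmem hcard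
  refine ⟨D, htr, hrun, ?_, _, hcard⟩
  rw [numUnmatched, ← Set.ncard_image_of_injective _ hX, ← Set.ncard_coe_finset]
  congr 1
  ext y
  rw [Finset.mem_coe, hmem]
  exact ⟨fun ⟨k, _, hk, hy⟩ => ⟨k, hk, hy⟩, fun ⟨k, hk, hy⟩ => ⟨k, k.2, hk, hy⟩⟩

/-! ### Points on the unit circle -/

/-- The rational parametrization of the unit circle. -/
noncomputable def circlePoint (x : ℕ) : Plane :=
  !₂[(1 - (x : ℝ) ^ 2) / (1 + (x : ℝ) ^ 2), 2 * (x : ℝ) / (1 + (x : ℝ) ^ 2)]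

theorem norm_circlePoint (x : ℕ) : ‖circlePoint x‖ = 1 := by
  have h : (0 : ℝ) < 1 + (x : ℝ) ^ 2 := by positivity
  rw [EuclideanSpace.norm_eq, Real.sqrt_eq_one]
  simp only [circlePoint, Fin.sum_univ_two, Real.norm_eq_abs, sq_abs]
  simp only [Matrix.cons_val_zero, Matrix.cons_val_one]
  field_simp
  ring

theorem circlePoint_injective : Function.Injective circlePoint := by
  intro x y h
  have hx : (0 : ℝ) < 1 + (x : ℝ) ^ 2 := by positivity
  have hy : (0 : ℝ) < 1 + (y : ℝ) ^ 2 := by positivity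
  have h0 := congrArg (fun v : Plane => v 0) h
  simp only [circlePoint, PiLp.toLp_apply, Matrix.cons_val_zero] at h0
  rw [div_eq_div_iff hx.ne' hy.ne'] at h0
  have h2 : (x : ℝ) ^ 2 = (y : ℝ) ^ 2 := by linarith
  exact_mod_cast (pow_left_inj₀ (Nat.cast_nonneg x) (Nat.cast_nonneg y) two_ne_zero).1 h2

theorem mem_segment_of_smul {P Q Z : Plane} {a b : ℝ} (ha : 0 < a) (hb : 0 < b)
    (h : (a + b) • Z = a • P + b • Q) : Z ∈ segment ℝ P Q := by
  have hab : a + b ≠ 0 := (add_pos ha hb).ne'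
  refine ⟨a / (a + b), b / (a + b), by positivity, by positivity,
    by rw [← add_div, div_self hab], ?_⟩
  rw [div_eq_inv_mul, div_eq_inv_mul, mul_smul, mul_smul, ← smul_add, ← h, smul_smul,
    inv_mul_cancel₀ hab, one_smul]

theorem not_disjoint_segment_of_interleaved {a b c d : ℕ} (hac : a < c) (hcb : c < b)
    (hbd : b < d) : ¬ Disjoint (segment ℝ (circlePoint a) (circlePoint b))
      (segment ℝ (circlePoint c) (circlePoint d)) := by
  have hac' : (0 : ℝ) < c - a := sub_pos.2 (Nat.cast_lt.2 hac)
  have hcb' : (0 : ℝ) < b - c := sub_pos.2 (Nat.cast_lt.2 hcb)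
  have hbd' : (0 : ℝ) < d - b := sub_pos.2 (Nat.cast_lt.2 hbd)
  have hab' : (0 : ℝ) < b - a := by linarith
  have hcd' : (0 : ℝ) < d - c := by linarith
  have had' : (0 : ℝ) < d - a := by linarith
  have hq : ∀ x : ℕ, (0 : ℝ) < 1 + (x : ℝ) ^ 2 := fun x => by positivity
  -- A third divided difference annihilates the quadratics `1 + x²`, `1 - x²` and `2x`. Multiplied
  -- by the Vandermonde product of the four nodes, its coefficients have alternating signs along `a
  -- < c < b < d`, which puts `a, b` and `c, d` on opposite sides of a common convex combination.
  obtain ⟨wa, hwa⟩ : ∃ w : ℝ, w = (1 + a ^ 2) * ((b - c) * (d - c) * (d - b)) := ⟨_, rfl⟩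
  obtain ⟨wb, hwb⟩ : ∃ w : ℝ, w = (1 + b ^ 2) * ((c - a) * (d - a) * (d - c)) := ⟨_, rfl⟩
  obtain ⟨wc, hwc⟩ : ∃ w : ℝ, w = (1 + c ^ 2) * ((b - a) * (d - a) * (d - b)) := ⟨_, rfl⟩
  obtain ⟨wd, hwd⟩ : ∃ w : ℝ, w = (1 + d ^ 2) * ((c - a) * (b - a) * (b - c)) := ⟨_, rfl⟩
  have ha0 : 0 < wa := by rw [hwa]; have := hq a; positivity
  have hb0 : 0 < wb := by rw [hwb]; have := hq b; positivity
  have hc0 : 0 < wc := by rw [hwc]; have := hq c; positivity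
  have hd0 : 0 < wd := by rw [hwd]; have := hq d; positivity
  have hsum : wa + wb = wc + wd := by rw [hwa, hwb, hwc, hwd]; ring
  have hsmul : ∀ (x : ℕ) (w : ℝ), ((1 + (x : ℝ) ^ 2) * w) • circlePoint x =
      !₂[(1 - (x : ℝ) ^ 2) * w, 2 * (x : ℝ) * w] := by
    intro x w
    have := (hq x).ne'
    ext i
    fin_cases i <;> simp [circlePoint] <;> field_simp
  have hpt : wa • circlePoint a + wb • circlePoint b = wc • circlePoint c + wd • circlePoint d := by
    rw [hwa, hwb, hwc, hwd, hsmul, hsmul, hsmul, hsmul]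
    ext i
    fin_cases i <;> simp <;> ring
  refine Set.not_disjoint_iff.2
    ⟨(wa + wb)⁻¹ • (wa • circlePoint a + wb • circlePoint b), ?_, ?_⟩
  · refine mem_segment_of_smul ha0 hb0 ?_
    rw [smul_inv_smul₀ (add_pos ha0 hb0).ne']
  · refine mem_segment_of_smul hc0 hd0 ?_
    rw [hpt, hsum, smul_inv_smul₀ (add_pos hc0 hd0).ne']

theorem segment_chord (a b : ℕ) :
    segment ℝ (circlePoint (chord a b).1) (circlePoint (chord a b).2) =
      segment ℝ (circlePoint a) (circlePoint b) := by
  rw [chord_eq]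
  rcases le_total a b with h | h
  · simp [h]
  · simp [h, segment_symm]

theorem not_disjoint_segment_of_crossing (a b c d : ℕ)
    (h : crossing (chord a b) (chord c d) = true) :
    ¬ Disjoint (segment ℝ (circlePoint c) (circlePoint d))
      (segment ℝ (circlePoint a) (circlePoint b)) := by
  rw [← segment_chord a b, ← segment_chord c d]
  rcases crossing_eq_true.1 h with ⟨h1, h2, h3⟩ | ⟨h1, h2, h3⟩
  · exact fun hdis => not_disjoint_segment_of_interleaved h1 h2 h3 hdis.symm
  · exact not_disjoint_segment_of_interleaved h1 h2 h3

theorem circlePoint_comp_mem {N : ℕ} {X : Fin N → ℕ} (hX : Function.Injective X)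
    {S : Set (Fin N → Plane)} (hS : S = generalPositionInputs N ∨ S = circleInputs N) :
    (fun k => circlePoint (X k)) ∈ S := by
  have hinj : Function.Injective fun k => circlePoint (X k) := circlePoint_injective.comp hX
  rcases hS with rfl | rfl
  · refine ⟨hinj, fun i j k hij hik hjk => ?_⟩
    rw [← affineIndependent_iff_not_collinear_set]
    have hcos : EuclideanGeometry.Cospherical
        ({circlePoint (X i), circlePoint (X j), circlePoint (X k)} : Set Plane) := by
      refine ⟨0, 1, ?_⟩
      rintro p (rfl | rfl | rfl) <;> rw [dist_zero_right, norm_circlePoint]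
    exact hcos.affineIndependent_of_ne (hinj.ne hij) (hinj.ne hik) (hinj.ne hjk)
  · exact ⟨hinj, 1, one_pos, fun i => norm_circlePoint _⟩

/-! ### The pigeonhole argument -/

theorem total_sum {ι : Type} (s : Finset ι) (bs : List (List (ℕ × List ℕ)))
    (F : ι → List (List ℕ) → ℝ) :
    total bs (fun ω => ∑ i ∈ s, F i ω) = ∑ i ∈ s, total bs (F i) := by
  induction bs generalizing F with
  | nil => rfl
  | cons B bs ih =>
    simp only [total, ih]
    induction B with
    | nil => simp [weightedSum]
    | cons a B ihB =>
      simp only [weightedSum, List.map_cons, List.sum_cons] at ihB ⊢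
      rw [ihB, Finset.sum_add_distrib, Finset.mul_sum]

theorem total_const (bs : List (List (ℕ × List ℕ))) (c : ℝ) :
    total bs (fun _ => c) =
      c * (bs.map fun B => (B.map fun a : ℕ × List ℕ => (a.1 : ℝ)).sum).prod := by
  induction bs with
  | nil => simp [total]
  | cons B bs ih =>
    simp only [total, ih, List.map_cons, List.prod_cons, weightedSum, List.sum_map_mul_right]
    ring

theorem mem_place_lt {bs : List (List (ℕ × List ℕ))} (hbs : ∀ B ∈ bs, IsBlock B)
    {ω : List (List ℕ)} (hω : Support bs ω) {off x : ℕ} (hx : x ∈ place off ω) : off < x := by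
  induction hω generalizing off with
  | nil => simp [place] at hx
  | @cons B l bs ω h _ ih =>
    obtain ⟨c, hc⟩ := h
    rcases List.mem_append.1 hx with hx | hx
    · obtain ⟨z, hz, rfl⟩ := List.mem_map.1 hx
      have := ((hbs B List.mem_cons_self _ hc).2.2.2 z hz).1
      omega
    · have := ih (fun B hB => hbs B (List.mem_cons_of_mem _ hB)) hx
      omega

theorem nodup_place {bs : List (List (ℕ × List ℕ))} (hbs : ∀ B ∈ bs, IsBlock B)
    {ω : List (List ℕ)} (hω : Support bs ω) (off : ℕ) : (place off ω).Nodup := by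
  induction hω generalizing off with
  | nil => exact List.nodup_nil
  | @cons B l bs ω h hω ih =>
    obtain ⟨c, hc⟩ := h
    have hbs' : ∀ B ∈ bs, IsBlock B := fun B hB => hbs B (List.mem_cons_of_mem _ hB)
    have hl := (hbs B List.mem_cons_self _ hc).2.2
    refine List.Nodup.append (hl.1.map (add_right_injective off)) (ih hbs' _) fun x hx hx' => ?_
    obtain ⟨z, hz, rfl⟩ := List.mem_map.1 hx
    have h1 := mem_place_lt hbs' hω hx'
    have h2 := (hl.2 z hz).2
    omega

theorem length_place {bs : List (List (ℕ × List ℕ))} (hbs : ∀ B ∈ bs, IsBlock B)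
    {ω : List (List ℕ)} (hω : Support bs ω) (off : ℕ) :
    (place off ω).length = (bs.map fun B => B.headI.2.length).sum := by
  induction hω generalizing off with
  | nil => rfl
  | @cons B l bs ω h hω ih =>
    obtain ⟨c, hc⟩ := h
    rw [place, List.length_append, List.length_map, (hbs B List.mem_cons_self _ hc).1,
      ih fun B hB => hbs B (List.mem_cons_of_mem _ hB)]
    rfl

theorem ofFn_getD {l : List ℕ} {N : ℕ} (h : l.length = N) :
    List.ofFn (fun k : Fin N => l.getD k 0) = l := by
  subst h
  refine List.ext_getElem (by simp) fun i h1 h2 => ?_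
  rw [List.getElem_ofFn, List.getD_eq_getElem]

/-- An algorithm with few bits of advice and few unmatched points cannot serve all inputs that the
blocks produce. -/
theorem total_weight_le {N : ℕ} {bs : List (List (ℕ × List ℕ))} (hbs : ∀ B ∈ bs, IsBlock B)
    (hN : (bs.map fun B => B.headI.2.length).sum = N) (A : Algorithm) (O : Oracle N) (b₀ u : ℕ)
    (h : ∀ X : Fin N → ℕ, Function.Injective X → ∃ b M,
      Outcome A (O fun k => circlePoint (X k)) (fun k => circlePoint (X k)) b M ∧ b ≤ b₀ ∧
        numUnmatched M ≤ u) :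
    (1 / 3 : ℝ) ^ u * (bs.map fun B => (B.map fun a : ℕ × List ℕ => (a.1 : ℝ)).sum).prod ≤
      2 ^ b₀ * (bs.map blockValue).prod := by
  classical
  let X : List (List ℕ) → Fin N → ℕ := fun ω k => (place 0 ω).getD k 0
  have hofFn : ∀ ω, Support bs ω → List.ofFn (X ω) = place 0 ω := fun ω hω =>
    ofFn_getD ((length_place hbs hω 0).trans hN)
  have hX : ∀ ω, Support bs ω → Function.Injective (X ω) := fun ω hω => by
    rw [← List.nodup_ofFn, hofFn ω hω]
    exact nodup_place hbs hω 0
  -- Fixing the first `b₀` bits and padding with `false` yields `2 ^ b₀` strategies without advice.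
  let tape : (Fin b₀ → Bool) → Tape := fun s k => if hk : k < b₀ then s ⟨k, hk⟩ else false
  let good : (Fin b₀ → Bool) → List (List ℕ) → Prop := fun s ω => ∃ b M,
    Outcome A (tape s) (fun k => circlePoint (X ω k)) b M ∧ numUnmatched M ≤ u
  let D : (Fin b₀ → Bool) → List (List ℕ) → List (Option ℕ) := fun s ω =>
    if hg : good s ω then (trace A (tape s) circlePoint (place 0 ω) (N + hg.choose)).2.2 else []
  have hrun : ∀ s ω, Support bs ω → good s ω →
      (∃ b, (trace A (tape s) circlePoint (place 0 ω) (N + b)).1 = N ∧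
        D s ω = (trace A (tape s) circlePoint (place 0 ω) (N + b)).2.2) ∧
      LegalRun (∅, []) (place 0 ω) (D s ω) ∧
      (run (∅, []) (place 0 ω) (D s ω)).1.card ≤ u := by
    intro s ω hω hg
    obtain ⟨M, hout, hu⟩ := hg.choose_spec
    obtain ⟨D', htr, hlegal, hcard, -⟩ :=
      hout.exists_run (hX ω hω) not_disjoint_segment_of_crossing
    rw [hofFn ω hω] at htr hlegal hcard
    have hD : D s ω = D' := by
      simp only [D, dif_pos hg, htr]
    rw [hD]
    exact ⟨⟨hg.choose, by rw [htr], by rw [htr]⟩, hlegal, hcard.trans_le hu⟩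
  let F : (Fin b₀ → Bool) → List (List ℕ) → ℝ := fun s ω =>
    if good s ω then potential (run (∅, []) (place 0 ω) (D s ω)) else 0
  have hF0 : ∀ s ω, 0 ≤ F s ω := by
    intro s ω
    simp only [F]
    split_ifs
    · exact (potential_pos _).le
    · exact le_rfl
  -- The oracle's own first `b₀` bits give one good strategy, since the run never reads further; the
  -- other terms are nonnegative.
  have hlower : ∀ ω, Support bs ω → (1 / 3 : ℝ) ^ u ≤ ∑ s, F s ω := by
    intro ω hω
    obtain ⟨b, M, hout, hb, hu⟩ := h (X ω) (hX ω hω)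
    let s : Fin b₀ → Bool := fun k => O (fun k => circlePoint (X ω k)) k
    have hg : good s ω := by
      refine ⟨b, M, hout.congr_tape fun k hk => ?_, hu⟩
      simp only [tape, s, dif_pos (hk.trans_le hb)]
    refine le_trans ?_ (Finset.single_le_sum (fun s _ => hF0 s ω) (Finset.mem_univ s))
    simp only [F, if_pos hg]
    exact (pow_le_pow_of_le_one (by norm_num) (by norm_num) (hrun s ω hω hg).2.2).trans
      (pow_card_le_potential _)
  have hupper : ∀ s, total bs (F s) ≤ (bs.map blockValue).prod := by
    intro s
    have hstart : Position.BoundedBy (∅, []) 0 := ⟨by simp, by simp⟩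
    refine (total_potential_le hbs hstart (fun ω hω hg => (hrun s ω hω hg).2.1) ?_).trans_eq ?_
    · intro ω ω' hω hω' hg hg' m hm
      obtain ⟨b, hb, hD⟩ := (hrun s ω hω hg).1
      obtain ⟨b', hb', hD'⟩ := (hrun s ω' hω' hg').1
      rw [hD, hD']
      exact take_trace_eq hm (hb.trans hb'.symm)
    · simp [potential]
  rw [← total_const]
  refine (total_le_total hlower).trans ?_
  rw [total_sum]
  refine (Finset.sum_le_sum fun s _ => hupper s).trans_eq ?_
  simp

/-! ### The inequality between advice, unmatched points and blocks. -/

theorem isBlock_six : IsBlock six := by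
  unfold IsBlock
  decide

theorem isBlock_four : IsBlock four := by
  unfold IsBlock
  decide

theorem blockValue_six_le : blockValue six ≤ 613 / 1000 * 198 := by
  have h : (1000 * gameValue 6 six [] [] 14 0 : ℝ) ≤ 613 * 198 * 126 ^ 24 := by
    exact_mod_cast gameValue_six_le
  rw [blockValue, div_le_iff₀ (by positivity)]
  change (gameValue 6 six [] [] 14 0 : ℝ) ≤ _
  linarith

theorem blockValue_four_le : blockValue four ≤ 79 / 100 * 100 := by
  have h : (100 * gameValue 4 four [] [] 14 0 : ℝ) ≤ 79 * 100 * 126 ^ 24 := by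
    exact_mod_cast gameValue_four_le
  rw [blockValue, div_le_iff₀ (by positivity)]
  change (gameValue 4 four [] [] 14 0 : ℝ) ≤ _
  linarith

theorem one_le_of_outcomes {N c₆ c₄ : ℕ} (hN : 6 * c₆ + 4 * c₄ = N) (A : Algorithm) (O : Oracle N)
    (b₀ u : ℕ)
    (h : ∀ X : Fin N → ℕ, Function.Injective X → ∃ b M,
      Outcome A (O fun k => circlePoint (X k)) (fun k => circlePoint (X k)) b M ∧ b ≤ b₀ ∧
        numUnmatched M ≤ u) :
    (1 : ℝ) ≤ 2 ^ b₀ * 3 ^ u * (613 / 1000) ^ c₆ * (79 / 100) ^ c₄ := by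
  have hbs : ∀ B ∈ List.replicate c₆ six ++ List.replicate c₄ four, IsBlock B := by
    intro B hB
    rcases List.mem_append.1 hB with hB | hB
    · rw [List.eq_of_mem_replicate hB]
      exact isBlock_six
    · rw [List.eq_of_mem_replicate hB]
      exact isBlock_four
  have hlen : ((List.replicate c₆ six ++ List.replicate c₄ four).map
      fun B => B.headI.2.length).sum = N := by
    simp only [List.map_append, List.map_replicate, List.sum_append, List.sum_replicate,
      smul_eq_mul]
    rw [← hN, mul_comm 6, mul_comm 4]
    rfl
  have key := total_weight_le hbs hlen A O b₀ u h
  simp only [List.map_append, List.map_replicate, List.prod_append, List.prod_replicate] at key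
  have h6 : (six.map fun a : ℕ × List ℕ => (a.1 : ℝ)).sum = 198 := by
    norm_num [six]
  have h4 : (four.map fun a : ℕ × List ℕ => (a.1 : ℝ)).sum = 100 := by
    norm_num [four]
  rw [h6, h4] at key
  have hnn : ∀ B, 0 ≤ blockValue B := fun B => by
    unfold blockValue
    positivity
  have h6' := pow_le_pow_left₀ (hnn six) blockValue_six_le c₆
  have h4' := pow_le_pow_left₀ (hnn four) blockValue_four_le c₄
  rw [mul_pow] at h6' h4'
  have hpos : (0 : ℝ) < (1 / 3) ^ u * (198 ^ c₆ * 100 ^ c₄) := by positivity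
  refine le_of_mul_le_mul_left ?_ hpos
  have h3 : (1 / 3 : ℝ) ^ u * 3 ^ u = 1 := by
    rw [← mul_pow]
    norm_num
  calc (1 / 3 : ℝ) ^ u * (198 ^ c₆ * 100 ^ c₄) * 1
      ≤ 2 ^ b₀ * (blockValue six ^ c₆ * blockValue four ^ c₄) := by rw [mul_one]; exact key
    _ ≤ 2 ^ b₀ * (((613 / 1000) ^ c₆ * 198 ^ c₆) * ((79 / 100) ^ c₄ * 100 ^ c₄)) := by
      have := hnn four
      gcongr
    _ = ((1 / 3 : ℝ) ^ u * 3 ^ u) *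
        (2 ^ b₀ * (((613 / 1000) ^ c₆ * 198 ^ c₆) * ((79 / 100) ^ c₄ * 100 ^ c₄))) := by
      rw [h3, one_mul]
    _ = _ := by ring

/-! ### Estimates -/

/-- Reduces numerical bounds on logarithms to comparisons of rational powers with powers of a
decimal approximation of `e`. -/
theorem log_le_of_pow_le_exp {x : ℝ} (hx : 0 < x) {k m : ℕ} (hk : 0 < k)
    (h : x ^ k ≤ Real.exp 1 ^ m) : Real.log x ≤ m / k := by
  have h' := Real.log_le_log (pow_pos hx k) h
  rw [Real.log_pow, Real.log_pow, Real.log_exp, mul_one] at h'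
  rw [le_div_iff₀ (Nat.cast_pos.2 hk), mul_comm]
  exact h'

theorem log_three_le : Real.log 3 ≤ 11 / 10 := by
  have h := log_le_of_pow_le_exp (x := 3) (k := 10) (m := 11) (by norm_num) (by norm_num)
    (le_trans (by norm_num) (pow_le_pow_left₀ (by norm_num) Real.exp_one_gt_d9.le 11))
  exact_mod_cast h

theorem log_seven_div_six_le : Real.log (7 / 6) ≤ 7 / 45 := by
  have h := log_le_of_pow_le_exp (x := 7 / 6) (k := 45) (m := 7) (by norm_num) (by norm_num)
    (le_trans (by norm_num) (pow_le_pow_left₀ (by norm_num) Real.exp_one_gt_d9.le 7))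
  exact_mod_cast h

theorem log_le_neg_of_pow_mul_exp_le {x : ℝ} (hx : 0 < x) {k m : ℕ} (hk : 0 < k)
    (h : x ^ k * 2.7182818286 ^ m ≤ 1) : Real.log x ≤ -(m / k) := by
  have h1 : x ^ k * Real.exp 1 ^ m ≤ 1 := by
    refine le_trans ?_ h
    have := Real.exp_one_lt_d9.le
    gcongr
  have h' := Real.log_nonpos (by positivity) h1
  rw [Real.log_mul (by positivity) (by positivity), Real.log_pow, Real.log_pow, Real.log_exp,
    mul_one] at h'
  have hk0 : (0 : ℝ) < k := Nat.cast_pos.2 hk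
  rw [← neg_div, le_div_iff₀ hk0]
  linarith

theorem log_four_div_three_le : 24 * Real.log (4 / 3) ≤ 10 * Real.log 2 := by
  have h := Real.log_le_log (x := (4 / 3) ^ 24) (y := 2 ^ 10) (by norm_num) (by norm_num)
  rw [Real.log_pow, Real.log_pow] at h
  exact_mod_cast h

/-- The claimed bound per pair of points, in natural units. -/
theorem bound_eq {α : ℝ} (hα : α ∈ Set.Ioo (16 / 17 : ℝ) 1) :
    α / 2 * relEntropy (2 * (1 - α) / α) (1 / 4) * Real.log 2 =
      (1 - α) * Real.log (8 * (1 - α) / α) +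
        (3 * α - 2) / 2 * Real.log (4 / 3 * ((3 * α - 2) / α)) := by
  have hα0 : α ≠ 0 := by linarith [hα.1]
  have hlog : Real.log 2 ≠ 0 := (Real.log_pos one_lt_two).ne'
  have h1 : 2 * (1 - α) / α / (1 / 4) = 8 * (1 - α) / α := by field_simp; ring
  have h2 : (1 - 2 * (1 - α) / α) / (1 - 1 / 4) = 4 / 3 * ((3 * α - 2) / α) := by
    field_simp
    ring
  rw [relEntropy, h1, h2, Real.logb, Real.logb]
  field_simp
  ring

/-- The right side is the limit of the bound as `α → 1`. The first term is nonpositive because `8 *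
(1 - α) ≤ α`. -/
theorem bound_le_half_log {α : ℝ} (hα : α ∈ Set.Ioo (16 / 17 : ℝ) 1) :
    (1 - α) * Real.log (8 * (1 - α) / α) +
      (3 * α - 2) / 2 * Real.log (4 / 3 * ((3 * α - 2) / α)) ≤ 1 / 2 * Real.log (4 / 3) := by
  obtain ⟨h1, h2⟩ := hα
  have hα0 : 0 < α := by linarith
  have hz : Real.log (8 * (1 - α) / α) ≤ 0 := by
    refine Real.log_nonpos (div_nonneg (by linarith) hα0.le) ?_
    rw [div_le_one hα0]
    linarith
  have hq : (3 * α - 2) / α ≤ 1 := by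
    rw [div_le_one hα0]
    linarith
  have hq0 : 0 < (3 * α - 2) / α := div_pos (by linarith) hα0
  have hlog : Real.log (4 / 3 * ((3 * α - 2) / α)) ≤ Real.log (4 / 3) :=
    Real.log_le_log (by positivity) (by linarith)
  have h43 : 0 ≤ Real.log (4 / 3) := Real.log_nonneg (by norm_num)
  nlinarith

/-- Both logarithms are replaced by tangent lines at their arguments for `α = 16 / 17`, where `8 *
(1 - α) / α = 1 / 2` and `(3 * α - 2) / α = 7 / 8`. A quadratic inequality on `[16 / 17, 1]`
remains. -/
theorem bound_add_le {α : ℝ} (hα : α ∈ Set.Ioo (16 / 17 : ℝ) 1) :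
    (1 - α) * Real.log (8 * (1 - α) / α) +
      (3 * α - 2) / 2 * Real.log (4 / 3 * ((3 * α - 2) / α)) + 2 * (1 - α) * Real.log 3 ≤
      153 / 1000 := by
  obtain ⟨h1, h2⟩ := hα
  have hα0 : 0 < α := by linarith
  have hz0 : 0 < 8 * (1 - α) / α := div_pos (by linarith) hα0
  have hq0 : 0 < (3 * α - 2) / α := div_pos (by linarith) hα0
  have hz : Real.log (8 * (1 - α) / α) ≤ 2 * (8 * (1 - α) / α) - 1 - 0.6931 := by
    have h := Real.log_le_sub_one_of_pos (mul_pos two_pos hz0)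
    rw [Real.log_mul two_ne_zero hz0.ne'] at h
    have := Real.log_two_gt_d9
    linarith
  have hq : Real.log (4 / 3 * ((3 * α - 2) / α)) ≤ 8 / 7 * ((3 * α - 2) / α) - 1 + 7 / 45 := by
    have hpos : 0 < 8 / 7 * ((3 * α - 2) / α) := by positivity
    have h := Real.log_le_sub_one_of_pos hpos
    have h76 := log_seven_div_six_le
    have heq : 4 / 3 * ((3 * α - 2) / α) = 7 / 6 * (8 / 7 * ((3 * α - 2) / α)) := by ring
    rw [heq, Real.log_mul (by norm_num) hpos.ne']
    linarith
  have h3 := log_three_le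
  have hbound : (1 - α) * (2 * (8 * (1 - α) / α) - 1 - 0.6931) +
      (3 * α - 2) / 2 * (8 / 7 * ((3 * α - 2) / α) - 1 + 7 / 45) + 2 * (1 - α) * (11 / 10) ≤
      153 / 1000 := by
    rw [← sub_nonneg]
    have heq : 153 / 1000 - ((1 - α) * (2 * (8 * (1 - α) / α) - 1 - 0.6931) +
      (3 * α - 2) / 2 * (8 / 7 * ((3 * α - 2) / α) - 1 + 7 / 45) + 2 * (1 - α) * (11 / 10)) =
      (153 / 1000 * α - ((1 - α) * (16 * (1 - α) - 1.6931 * α) +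
        (3 * α - 2) / 2 * (8 / 7 * (3 * α - 2) - 38 / 45 * α) + 11 / 5 * (1 - α) * α)) / α := by
      field_simp
      ring
    rw [heq]
    refine div_nonneg ?_ hα0.le
    nlinarith [mul_nonneg (sub_nonneg.2 h1.le) (sub_nonneg.2 h2.le)]
  have e1 := mul_le_mul_of_nonneg_left hz (by linarith : (0 : ℝ) ≤ 1 - α)
  have e2 := mul_le_mul_of_nonneg_left hq (by linarith : (0 : ℝ) ≤ (3 * α - 2) / 2)
  have e3 := mul_le_mul_of_nonneg_left h3 (by linarith : (0 : ℝ) ≤ 2 * (1 - α))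
  linarith

theorem not_one_le_of_small {c₆ c₄ b₀ : ℕ} (hc₄ : c₄ ≤ 2) (hpos : 2 ≤ 3 * c₆ + 2 * c₄)
    (hle : 3 * c₆ + 2 * c₄ ≤ 16) (hb : 24 * b₀ < 5 * (3 * c₆ + 2 * c₄)) :
    ¬ (1 : ℝ) ≤ 2 ^ b₀ * 3 ^ 0 * (613 / 1000) ^ c₆ * (79 / 100) ^ c₄ := by
  have hc₆ : c₆ ≤ 5 := by omega
  have hb' : b₀ ≤ 5 * (3 * c₆ + 2 * c₄) / 24 := by omega
  intro h
  have h2 : (2 : ℝ) ^ b₀ ≤ 2 ^ (5 * (3 * c₆ + 2 * c₄) / 24) :=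
    pow_le_pow_right₀ one_le_two hb'
  have h' : (1 : ℝ) ≤ 2 ^ (5 * (3 * c₆ + 2 * c₄) / 24) * 3 ^ 0 * (613 / 1000) ^ c₆ *
      (79 / 100) ^ c₄ := h.trans (by gcongr)
  clear h h2 hb hb'
  interval_cases c₆ <;> interval_cases c₄ <;> first | omega | norm_num at h'

/-- Advice and unmatched points contribute at most 0.459 per block of six and 0.306 per block of
four to the logarithm; the blocks subtract 20/41 and 4/17. Each six gains about 0.0288 and each four
loses about 0.0707, so five sixes outweigh two fours. -/
theorem not_one_le_of_large {α : ℝ} (hα : α ∈ Set.Ioo (16 / 17 : ℝ) 1) {c₆ c₄ b₀ u : ℕ}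
    (hc₄ : c₄ ≤ 2) (hc₆ : 5 ≤ c₆)
    (hb : (b₀ : ℝ) ≤ α / 2 * relEntropy (2 * (1 - α) / α) (1 / 4) * (3 * c₆ + 2 * c₄))
    (hu : (u : ℝ) ≤ 2 * (1 - α) * (3 * c₆ + 2 * c₄)) :
    ¬ (1 : ℝ) ≤ 2 ^ b₀ * 3 ^ u * (613 / 1000) ^ c₆ * (79 / 100) ^ c₄ := by
  intro h
  have hlog := Real.log_nonneg h
  rw [Real.log_mul (by positivity) (by positivity), Real.log_mul (by positivity) (by positivity),
    Real.log_mul (by positivity) (by positivity), Real.log_pow, Real.log_pow, Real.log_pow,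
    Real.log_pow] at hlog
  have h6 : Real.log (613 / 1000) ≤ -(20 / 41) := by
    have := log_le_neg_of_pow_mul_exp_le (x := 613 / 1000) (k := 41) (m := 20) (by norm_num)
      (by norm_num) (by norm_num)
    exact_mod_cast this
  have h4 : Real.log (79 / 100) ≤ -(4 / 17) := by
    have := log_le_neg_of_pow_mul_exp_le (x := 79 / 100) (k := 17) (m := 4) (by norm_num)
      (by norm_num) (by norm_num)
    exact_mod_cast this
  have h2pos : 0 ≤ Real.log 2 := (Real.log_pos one_lt_two).le
  have h3pos : 0 ≤ Real.log 3 := (Real.log_pos (by norm_num)).le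
  have hn : (0 : ℝ) ≤ 3 * c₆ + 2 * c₄ := by positivity
  have e1 := mul_le_mul_of_nonneg_right hb h2pos
  have e2 := mul_le_mul_of_nonneg_right hu h3pos
  have e3 := mul_le_mul_of_nonneg_right (bound_add_le hα) hn
  have e4 := mul_le_mul_of_nonneg_left h6 (Nat.cast_nonneg (α := ℝ) c₆)
  have e5 := mul_le_mul_of_nonneg_left h4 (Nat.cast_nonneg (α := ℝ) c₄)
  have hc₆' : (5 : ℝ) ≤ c₆ := by exact_mod_cast hc₆
  have hc₄' : (c₄ : ℝ) ≤ 2 := by exact_mod_cast hc₄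
  rw [← bound_eq hα] at e3
  linarith

end MNM

/-! ### Conclusion: an algorithm that always reads fewer bits is contradictory. -/

/-- The worst-case number of advice bits read by `A` on inputs of `2 * n` points (in general
position, or on a circle) is at least the bound, i.e. some input makes it read that many bits. -/
theorem theorem6 (n : ℕ) (hn : 2 ≤ n) (α : ℝ) (hα : α ∈ Set.Ioo (16 / 17 : ℝ) 1)
    (S : Set (Fin (2 * n) → Plane))
    (hS : S = MNM.generalPositionInputs (2 * n) ∨ S = MNM.circleInputs (2 * n))
    (A : MNM.Algorithm) (O : MNM.Oracle (2 * n))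
    (hA : MNM.GuaranteesUnmatchedLE A O S (2 * (1 - α) * n)) :
    ∃ p ∈ S, ∃ b M, MNM.Outcome A (O p) p b M ∧
      α / 2 * MNM.relEntropy (2 * (1 - α) / α) (1 / 4) * n ≤ (b : ℝ) := by
  by_contra! hcon
  set β := α / 2 * MNM.relEntropy (2 * (1 - α) / α) (1 / 4) * n with hβ
  have hmem : ∀ X : Fin (2 * n) → ℕ, Function.Injective X →
      (fun k => MNM.circlePoint (X k)) ∈ S := fun X hX => MNM.circlePoint_comp_mem hX hS
  have hβ0 : 0 < β := by
    obtain ⟨b, M, hout, -⟩ := hA _ (hmem _ Fin.val_injective)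
    exact (Nat.cast_nonneg b).trans_lt (hcon _ (hmem _ Fin.val_injective) b M hout)
  have hceil := Nat.ceil_pos.2 hβ0
  -- The largest natural number below `β`, which is positive since some run reads fewer than `β`
  -- bits.
  have hb₀ : ((⌈β⌉₊ - 1 : ℕ) : ℝ) < β := by
    rw [← Nat.lt_ceil]
    omega
  have hruns : ∀ u : ℕ, (∀ m : ℕ, (m : ℝ) ≤ 2 * (1 - α) * n → (∃ c, m + 2 * c = 2 * n) → m ≤ u) →
      ∀ X : Fin (2 * n) → ℕ, Function.Injective X → ∃ b M,
        MNM.Outcome A (O fun k => MNM.circlePoint (X k)) (fun k => MNM.circlePoint (X k)) b M ∧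
          b ≤ ⌈β⌉₊ - 1 ∧ MNM.numUnmatched M ≤ u := by
    intro u hu X hX
    obtain ⟨b, M, hout, hle⟩ := hA _ (hmem X hX)
    refine ⟨b, M, hout, ?_, hu _ hle ?_⟩
    · have := Nat.lt_ceil.2 (hcon _ (hmem X hX) b M hout)
      omega
    · obtain ⟨D, -, -, hcard, c, hc⟩ :=
        hout.exists_run hX MNM.not_disjoint_segment_of_crossing
      exact ⟨c, hcard ▸ hc⟩
  -- As few blocks of four as possible: `2 * c₄ ≡ n` modulo 3 means `c₄ ≡ 2 * n`. The hypothesis `2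
  -- ≤ n` keeps the subtraction from truncating.
  obtain ⟨c₆, c₄, hc, hc₄⟩ : ∃ c₆ c₄, 3 * c₆ + 2 * c₄ = n ∧ c₄ ≤ 2 :=
    ⟨(n - 2 * (2 * n % 3)) / 3, 2 * n % 3, by omega, by omega⟩
  have hc' : (3 * c₆ + 2 * c₄ : ℝ) = n := by exact_mod_cast hc
  have hN : 6 * c₆ + 4 * c₄ = 2 * n := by omega
  rcases le_or_gt n 16 with hsmall | hlarge
  · refine MNM.not_one_le_of_small hc₄ (hc ▸ hn) (hc ▸ hsmall) ?_
      (MNM.one_le_of_outcomes hN A O (⌈β⌉₊ - 1) 0 (hruns 0 ?_))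
    -- From `log₂ (4 / 3) ≤ 5 / 12`, the bound is at most `5 * n / 24`.
    · rw [hc]
      have h1 := MNM.bound_le_half_log hα
      rw [← MNM.bound_eq hα] at h1
      have h2 := Real.log_pos one_lt_two
      have h3 := mul_lt_mul_of_pos_right hb₀ h2
      have h4 := mul_le_mul_of_nonneg_right h1 (Nat.cast_nonneg (α := ℝ) n)
      have h5 := mul_le_mul_of_nonneg_right MNM.log_four_div_three_le (Nat.cast_nonneg (α := ℝ) n)
      have h6 : (24 * (⌈β⌉₊ - 1 : ℕ) : ℝ) * Real.log 2 < 5 * n * Real.log 2 := by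
        have h7 : β * Real.log 2 =
            α / 2 * MNM.relEntropy (2 * (1 - α) / α) (1 / 4) * Real.log 2 * n := by
          rw [hβ]
          ring
        linarith
      exact_mod_cast lt_of_mul_lt_mul_right h6 h2.le
    -- For `n ≤ 16` fewer than two points stay unmatched; their number is even, hence zero.
    · rintro m hm ⟨c, hmc⟩
      have hn' : (n : ℝ) ≤ 16 := by exact_mod_cast hsmall
      have hm2 : (m : ℝ) < 2 := by nlinarith [hα.1, hα.2]
      have hm2' : m < 2 := by exact_mod_cast hm2
      omega
  · refine MNM.not_one_le_of_large hα hc₄ (by omega) ?_ ?_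
      (MNM.one_le_of_outcomes hN A O (⌈β⌉₊ - 1) ⌊2 * (1 - α) * n⌋₊
        (hruns _ fun m hm _ => Nat.le_floor hm))
    · rw [hc']
      exact hb₀.le
    · rw [hc']
      have := hα.2
      exact Nat.floor_le (mul_nonneg (by linarith) (Nat.cast_nonneg n))
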